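/- Let $A\in\mathbb R^{m\times n}$, $H\in\mathbb R^{p\times n}$, $b\in\mathbb R^m$, $h\in\mathbb R^p$, $X=\{x\in\mathbb R^n: Hx\le h\}$, and consider the problem $\min_{x\in X,\,Ax=b} f(x)$, where $f:\mathbb R^n\to\mathbb R$ is $L_f$-smooth (differentiable with $L_f$-Lipschitz gradient, $L_f\ge 0$), the feasible set $\{x\in X: Ax=b\}$ is nonempty, and $f$ is bounded below on it. Norms are Euclidean, and $\|A\|$ is the operator norm. Let $\rho\ge 0$ and let $F$ be a stochastic gradient oracle with $\mathbb E_\xi[F(x,\xi)]=\nabla f(x)$ and $\mathbb E_\xi\|F(x,\xi)-\nabla f(x)\|^2\le\sigma^2$ for all $x$. Let $L_\rho(x,y)=f(x)+\langle Ax-b,y\rangle+\frac\rho2\|Ax-b\|^2$. Algorithm (stochastic smoothed and linearized ALM). Given $x_0=z_0\in X$ and $y_0\in\mathbb R^m$, for $t=0,1,\dots,T-1$ with i.i.d. samples $\xi_t$: $$y_{t+1}=y_t+\eta(Ax_t-b),\qquad G_t=F(x_t,\xi_t)+A^\top y_{t+1}+\rho A^\top(Ax_t-b)+\mu(x_t-z_t),$$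 $$x_{t+1}=\mathrm{proj}_X(x_t-\tau G_t),\qquad z_{t+1}=z_t+\beta(x_t-z_t).$$ Parameters: $\mu=\max\{2,4L_f\}$, $\lambda=L_K=L_f+\rho\|A\|^2+\mu$, $\gamma_s=2\mu+\rho\|A\|^2$, $\tau=\frac1{6\lambda^2\sqrt T}$, $$\eta=\min\Big\{\frac{\gamma_s}{4\|A\|^4},\frac{\tau}{200\|A\|^2},\frac{\tau\gamma_s}{20\|A\|^2}\Big\},\qquad \beta=\min\Big\{\frac{\tau}{100},\frac1{50\lambda},\frac{\eta}{36\mu\bar\sigma^2}\Big\}$$ (if $A=0$, where the three bounds on $\eta$ are void, $\eta=\tau$). Here $\bar\sigma>0$ is a global error bound constant: $\|x^*(y,z)-\bar x^*(z)\|\le\bar\sigma\|Ax^*(y,z)-b\|$ for all $y,z$, where $x^*(y,z)=\arg\min_{x\in X}\{L_\rho(x,y)+\frac\mu2\|x-z\|^2\}$ and $\bar x^*(z)=\arg\min_{x\in X,\,Ax=b}\{f(x)+\frac\mu2\|x-z\|^2\}$. For $\kappa>0$ let $\Psi_\kappa(z)=\min_{x\in X,\,Ax=b}\{f(x)+\frac\kappa2\|x-z\|^2\}$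 be the Moreau envelope of the constrained problem. Theorem. (i) For given $A,H,L_f,\rho$ there is a $\bar\sigma>0$, depending only on these, that is a global error bound constant for all $b,h$ and all $L_f$-smooth $f$. (ii) Let $\bar\sigma$ be any global error bound constant of the problem and let $\Psi=\Psi_\kappa$ with $\kappa=\mu$ or $\kappa=\lambda$. Then $\Psi$ is differentiable, and there are $c_1,c_2>0$, which may depend on the problem data, $L_f$, $\rho$, $\bar\sigma$, $\sigma$, $x_0$, $y_0$ but not on $\varepsilon$, $T$ or the oracle, such that: (a) for every $\varepsilon>0$ and every integer $T\ge\max\{1,c_1\varepsilon^{-4}\}$, running the algorithm with the above parameters, which uses exactly one call of the oracle (one sample) per iteration and hence exactly $T$ calls in total, gives $$\mathbb E\|\nabla\Psi(z_{t^*})\|\le\varepsilon$$ for $t^*$ uniform on $\{1,\dots,T\}$ and independent of the samples; (b) for every $\varepsilon\in(0,1]$ there is an integer $T$ with $c_1\varepsilon^{-4}\le T\le c_2\varepsilon^{-4}$. So $T=\Theta(\varepsilon^{-4})$ iterations suffice, and the stochastic oracle complexity is $O(\varepsilon^{-4})$. -/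

import Mathlib

open MeasureTheory ProbabilityTheory

noncomputable section

namespace SmoothedALM

/-- `ℝⁿ` with the Euclidean norm. -/
abbrev Vec (n : ℕ) : Type := EuclideanSpace ℝ (Fin n)

/-- The data of the problem `min f x` subject to `H x ≤ h`, `A x = b`. The matrices `A` and `H` are
given as the linear maps they represent; `‖A‖` is the operator norm. -/
structure Problem (n m p : ℕ) where
  f : Vec n → ℝ
  A : Vec n →L[ℝ] Vec m
  b : Vec m
  H : Vec n →L[ℝ] Vec p
  h : Vec p

/-- `f` is `L`-smooth: differentiable with `L`-Lipschitz gradient. -/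
def IsSmoothFun {n : ℕ} (L : ℝ) (f : Vec n → ℝ) : Prop :=
  Differentiable ℝ f ∧ ∀ x y, ‖gradient f x - gradient f y‖ ≤ L * ‖x - y‖

section Objects

variable {n m p : ℕ}

/-- The polyhedron `X = {x : H x ≤ h}`. -/
def Problem.X (Q : Problem n m p) : Set (Vec n) := {x | ∀ i, Q.H x i ≤ Q.h i}

/-- The feasible set `{x ∈ X : A x = b}`. -/
def Problem.feasible (Q : Problem n m p) : Set (Vec n) := {x | x ∈ Q.X ∧ Q.A x = Q.b}

/-- The augmented Lagrangian `L_ρ(x, y) = f x + ⟨A x - b, y⟩ + (ρ/2) ‖A x - b‖²`. -/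
def Problem.augLag (Q : Problem n m p) (ρ : ℝ) (x : Vec n) (y : Vec m) : ℝ :=
  Q.f x + inner ℝ (Q.A x - Q.b) y + ρ / 2 * ‖Q.A x - Q.b‖ ^ 2

/-- The Moreau envelope `z ↦ min {f x + (κ/2) ‖x - z‖² : x ∈ X, A x = b}`. -/
def Problem.envelope (Q : Problem n m p) (κ : ℝ) (z : Vec n) : ℝ :=
  ⨅ x : Q.feasible, (Q.f x + κ / 2 * ‖(x : Vec n) - z‖ ^ 2)

/-- `σbar` is a global error bound constant: for all `y`, `z`, the minimizer `x` over `X` of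
`L_ρ(·, y) + (μ/2) ‖· - z‖²` and the minimizer `xbar` over the feasible set of
`f + (μ/2) ‖· - z‖²` satisfy `‖x - xbar‖ ≤ σbar ‖A x - b‖`. -/
def Problem.IsErrorBound (Q : Problem n m p) (ρ μ σbar : ℝ) : Prop :=
  ∀ (y : Vec m) (z x xbar : Vec n),
    x ∈ Q.X → IsMinOn (fun u => Q.augLag ρ u y + μ / 2 * ‖u - z‖ ^ 2) Q.X x →
    xbar ∈ Q.feasible → IsMinOn (fun u => Q.f u + μ / 2 * ‖u - z‖ ^ 2) Q.feasible xbar →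
    ‖x - xbar‖ ≤ σbar * ‖Q.A x - Q.b‖

/-- A nearest point of `S` to `v`; this is the projection when `S` is nonempty, closed, convex. -/
def proj (S : Set (Vec n)) (v : Vec n) : Vec n :=
  Classical.epsilon fun q => q ∈ S ∧ ∀ w ∈ S, ‖v - q‖ ≤ ‖v - w‖

end Objects

/-! Parameters -/

/-- `μ = max {2, 4 L_f}`. -/
def muParam (Lf : ℝ) : ℝ := max 2 (4 * Lf)

/-- `λ = L_K = L_f + ρ ‖A‖² + μ`; the argument `a` stands for `‖A‖`. -/
def lamParam (Lf ρ a : ℝ) : ℝ := Lf + ρ * a ^ 2 + muParam Lf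

/-- `τ = 1 / (6 λ² √T)`. -/
def tauParam (Lf ρ a : ℝ) (T : ℕ) : ℝ := 1 / (6 * lamParam Lf ρ a ^ 2 * √(T : ℝ))

/-- `γ_s = μ - L_f + λ = 2 μ + ρ ‖A‖²`. -/
def gammaS (Lf ρ a : ℝ) : ℝ := 2 * muParam Lf + ρ * a ^ 2

open Classical in
/-- `η = min {γ_s / (4 ‖A‖⁴), τ / (200 ‖A‖²), τ γ_s / (20 ‖A‖²)}`. If `A = 0`, these three upper
bounds are infinite; then we take `η = τ`. -/
def etaParam (Lf ρ a : ℝ) (T : ℕ) : ℝ :=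
  if a = 0 then tauParam Lf ρ a T
  else min (gammaS Lf ρ a / (4 * a ^ 4))
    (min (tauParam Lf ρ a T / (200 * a ^ 2))
      (tauParam Lf ρ a T * gammaS Lf ρ a / (20 * a ^ 2)))

/-- `β = min {τ / 100, 1 / (50 λ), η / (36 μ σbar²)}`. -/
def betaParam (Lf ρ a σbar : ℝ) (T : ℕ) : ℝ :=
  min (tauParam Lf ρ a T / 100)
    (min (1 / (50 * lamParam Lf ρ a)) (etaParam Lf ρ a T / (36 * muParam Lf * σbar ^ 2)))

/-- The parameters that the algorithm uses. -/
structure Params where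
  ρ : ℝ
  μ : ℝ
  τ : ℝ
  η : ℝ
  β : ℝ

/-- The parameter choice for a horizon of `T` iterations. -/
def params (Lf ρ a σbar : ℝ) (T : ℕ) : Params where
  ρ := ρ
  μ := muParam Lf
  τ := tauParam Lf ρ a T
  η := etaParam Lf ρ a T
  β := betaParam Lf ρ a σbar T

/-! Programs with access to a stochastic first-order oracle -/

/-- A program that may query a stochastic gradient oracle at points of `ℝⁿ`. -/
inductive OracleProg (n : ℕ) (α : Type) : Type where
  | ret : α → OracleProg n α
  | query : Vec n → (Vec n → OracleProg n α) → OracleProg n α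

/-- Sequential composition. -/
def OracleProg.bind {n : ℕ} {α β : Type} : OracleProg n α → (α → OracleProg n β) → OracleProg n β
  | .ret a, k => k a
  | .query x c, k => .query x fun g => (c g).bind k

/-- Execution with oracle `F` and sample stream `ξ`, when `k` oracle calls were made before. Every
query at `x` uses up one fresh sample `s` and is answered by `F x s`. The output is the returned
value and the total number of oracle calls. -/
def OracleProg.exec {n : ℕ} {α : Type} {Ξ : Type*} (F : Vec n → Ξ → Vec n) (ξ : ℕ → Ξ) :
    OracleProg n α → ℕ → α × ℕ
  | .ret a, k => (a, k)
  | .query x c, k => (c (F x (ξ k))).exec F ξ (k + 1)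

/-- The state `(x_t, y_t, z_t)`. -/
structure State (n m : ℕ) where
  x : Vec n
  y : Vec m
  z : Vec n

section Algorithm

variable {n m p : ℕ}

/-- One iteration of the stochastic smoothed and linearized ALM: with `g` the answer of the oracle
at `x_t` and `y_{t+1} = y_t + η (A x_t - b)`, the stochastic gradient of the proximal augmented
Lagrangian is `G = g + Aᵀ y_{t+1} + ρ Aᵀ (A x_t - b) + μ (x_t - z_t)`, and
`x_{t+1} = proj_X (x_t - τ G)`, `z_{t+1} = z_t + β (x_t - z_t)`. -/
def Problem.step (Q : Problem n m p) (θ : Params) (s : State n m) : OracleProg n (State n m) :=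
  let r := Q.A s.x - Q.b
  let y' := s.y + θ.η • r
  .query s.x fun g =>
    let G := g + Q.A.adjoint y' + θ.ρ • Q.A.adjoint r + θ.μ • (s.x - s.z)
    .ret
      { x := proj Q.X (s.x - θ.τ • G)
        y := y'
        z := s.z + θ.β • (s.x - s.z) }

/-- `t` iterations of the algorithm, started at `z₀ = x₀` and `y₀`. -/
def Problem.alm (Q : Problem n m p) (θ : Params) (x₀ : Vec n) (y₀ : Vec m) :
    ℕ → OracleProg n (State n m)
  | 0 => .ret { x := x₀, y := y₀, z := x₀ }
  | t + 1 => (Q.alm θ x₀ y₀ t).bind (Q.step θ)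

/-- The iterate `z_t` for the oracle `F` and the sample stream `ξ`. -/
def Problem.zIter (Q : Problem n m p) (θ : Params) (x₀ : Vec n) (y₀ : Vec m) {Ξ : Type*}
    (F : Vec n → Ξ → Vec n) (ξ : ℕ → Ξ) (t : ℕ) : Vec n :=
  ((Q.alm θ x₀ y₀ t).exec F ξ 0).1.z

/-- The number of oracle calls in `T` iterations. -/
def Problem.oracleCalls (Q : Problem n m p) (θ : Params) (x₀ : Vec n) (y₀ : Vec m) {Ξ : Type*}
    (F : Vec n → Ξ → Vec n) (ξ : ℕ → Ξ) (T : ℕ) : ℕ :=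
  ((Q.alm θ x₀ y₀ T).exec F ξ 0).2

/-- `F` is an unbiased stochastic gradient of `f` with variance at most `σ²`, for samples with
law `D`. -/
structure IsStochGrad {Ξ : Type*} [MeasurableSpace Ξ] (f : Vec n → ℝ) (F : Vec n → Ξ → Vec n)
    (D : Measure Ξ) (σ : ℝ) : Prop where
  measurable : Measurable (Function.uncurry F)
  integrable : ∀ x, Integrable (F x) D
  unbiased : ∀ x, ∫ s, F x s ∂D = gradient f x
  integrable_sq : ∀ x, Integrable (fun s => ‖F x s - gradient f x‖ ^ 2) D
  variance_le : ∀ x, ∫ s, ‖F x s - gradient f x‖ ^ 2 ∂D ≤ σ ^ 2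

end Algorithm

end SmoothedALM

end

/-!
The algorithm descends, in expectation, along the potential
`V(x, y, z) = ‖x - x*(y, z)‖² - d(y, z) + 2 Ψ_μ(z)` (`Problem.potential`), where
`K(u, y, z) = L_ρ(u, y) + (μ/2) ‖u - z‖²` is the proximal augmented Lagrangian, `x*(y, z)` its
minimizer over `X`, and `d(y, z) = K(x*(y, z), y, z)` the dual function. Weak duality `d ≤ Ψ_μ`
bounds `V` below by the lower bound of `f` on the feasible set.

Since `K` is strongly convex and smooth in `u`, the projected stochastic gradient step contracts the
distance of `x` to `x*(y⁺, z)`, up to noise of order `τ²` (`Admissible.proj_step`). The dual step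
raises `d` by about `η ‖A x* - b‖²`, because `d` is concave in `y` (`Admissible.dual_ascent`), and
the proximal step lowers `2 Ψ_μ - d` by about `μ β ‖x - z‖²`. The remaining first-order term pairs
`x - z` with `x* - x̄(z)`; by the error bound, the dual ascent dominates it. The displacements of
`x*` caused by the dual and proximal steps are negligible because `η ‖A‖² ≤ τ / 200` and
`β ≤ τ / 100`. The three gains together dominate `‖z - x̄(z)‖²`
(`Admissible.deterministic_descent`), and `∇Ψ_κ(z) = κ (z - x̄_κ(z))`
(`Problem.hasGradientAt_envelope`), where `‖z - x̄_κ(z)‖` is nonincreasing in `κ`. Adding up the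
iterations, with `τ, β ∼ 1/√T`, gives `E ‖∇Ψ(z_{t*})‖² ≤ C / √T`. Expectations are taken as lower
Lebesgue integrals of nonnegative quantities, so that integrability of the iterates is a
consequence and not a prerequisite.

The error bound (`exists_isErrorBound`) is the Lipschitz dependence of the minimizer of a strongly
convex smooth function over `{u : H u ≤ h, A u = c}` on `c`, with a constant independent of `h`.
Along a segment of right-hand sides, the minimizer is Lipschitz on each set of parameters on which
the gradient is orthogonal to `{w : A w = 0, H_I w = 0}` and the rows `H_I` are active, because `A`
is injective on the orthogonal complement of that space within `ker H_I`. These sets are closed,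
finitely many, and cover the segment (`norm_sub_le_of_polyhedron`).
-/

noncomputable section

namespace SmoothedALM

/-! ### Functions with two-sided quadratic bounds -/

section QuadBounds

variable {E : Type*} [NormedAddCommGroup E] [InnerProductSpace ℝ E]

/-- `g` lies between the two quadratic models `g u + ⟨g' u, w - u⟩ + (c/2) ‖w - u‖²`, `c = m, M`,
at every `u`. For `m > 0` this encodes that `g` is `m`-strongly convex, `M`-smooth and has the
gradient `g'`, in the only form in which these facts are used. -/
def QuadBounds (g : E → ℝ) (g' : E → E) (m M : ℝ) : Prop :=
  ∀ u w, g u + inner ℝ (g' u) (w - u) + m / 2 * ‖w - u‖ ^ 2 ≤ g w ∧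
    g w ≤ g u + inner ℝ (g' u) (w - u) + M / 2 * ‖w - u‖ ^ 2

/-- First-order optimality (a variational inequality) on a convex set. -/
def IsStationary (g' : E → E) (S : Set E) (u : E) : Prop :=
  u ∈ S ∧ ∀ w ∈ S, 0 ≤ inner ℝ (g' u) (w - u)

variable {g : E → ℝ} {g' : E → E} {m M : ℝ} {S : Set E}

lemma QuadBounds.strongMono (h : QuadBounds g g' m M) (u w : E) :
    m * ‖u - w‖ ^ 2 ≤ inner ℝ (g' u - g' w) (u - w) := by
  have h1 := (h u w).1
  have h2 := (h w u).1
  rw [norm_sub_rev w u] at h1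
  have e : inner ℝ (g' u) (w - u) = - inner ℝ (g' u) (u - w) := by
    rw [← inner_neg_right, neg_sub]
  rw [inner_sub_left]
  linarith

lemma QuadBounds.continuous (h : QuadBounds g g' m M) : Continuous g := by
  rw [continuous_iff_continuousAt]
  intro u
  have hc : ∀ c : ℝ, Filter.Tendsto
      (fun w => g u + inner ℝ (g' u) (w - u) + c / 2 * ‖w - u‖ ^ 2) (nhds u) (nhds (g u)) := by
    intro c
    have : Continuous (fun w => g u + inner ℝ (g' u) (w - u) + c / 2 * ‖w - u‖ ^ 2) := by
      fun_prop
    simpa using this.tendsto u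
  exact tendsto_of_tendsto_of_tendsto_of_le_of_le (hc m) (hc M) (fun w => (h u w).1)
    (fun w => (h u w).2)

lemma QuadBounds.exists_isMinOn [FiniteDimensional ℝ E] (h : QuadBounds g g' m M) (hm : 0 < m)
    (hS : IsClosed S) (hne : S.Nonempty) : ∃ u ∈ S, IsMinOn g S u := by
  obtain ⟨u, hu⟩ := hne
  -- outside this radius, the lower quadratic model at `u` exceeds `g u`
  set R := 2 * ‖g' u‖ / m with hR
  refine h.continuous.continuousOn.exists_isMinOn' hS hu ?_
  have hK : IsCompact (Metric.closedBall u R) := isCompact_closedBall u R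
  refine Filter.mem_inf_of_left ?_
  filter_upwards [hK.compl_mem_cocompact] with w hw
  have hw' : R < ‖w - u‖ := by
    simpa [Metric.mem_closedBall, dist_eq_norm] using hw
  have h1 := (h u w).1
  have h2 : -(‖g' u‖ * ‖w - u‖) ≤ inner ℝ (g' u) (w - u) :=
    (abs_le.1 (abs_real_inner_le_norm _ _)).1
  have h3 : 2 * ‖g' u‖ < ‖w - u‖ * m := by rwa [hR, div_lt_iff₀ hm] at hw'
  have h4 : 0 ≤ ‖w - u‖ := norm_nonneg _
  show g u ≤ g w
  nlinarith

lemma QuadBounds.isStationary (h : QuadBounds g g' m M) (hS : Convex ℝ S) {u : E} (hu : u ∈ S)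
    (hmin : IsMinOn g S u) : IsStationary g' S u := by
  refine ⟨hu, fun w hw => ?_⟩
  have key : ∀ t : ℝ, 0 < t → t ≤ 1 →
      0 ≤ inner ℝ (g' u) (w - u) + t * (M / 2 * ‖w - u‖ ^ 2) := by
    intro t ht0 ht1
    have hmem : u + t • (w - u) ∈ S := hS.add_smul_sub_mem hu hw ⟨ht0.le, ht1⟩
    have h1 : g u ≤ g (u + t • (w - u)) := hmin hmem
    have h2 := (h u (u + t • (w - u))).2
    rw [add_sub_cancel_left, inner_smul_right, norm_smul, mul_pow, Real.norm_eq_abs, sq_abs] at h2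
    have : 0 ≤ t * (inner ℝ (g' u) (w - u) + t * (M / 2 * ‖w - u‖ ^ 2)) := by nlinarith
    exact nonneg_of_mul_nonneg_right this ht0
  have hlim : Filter.Tendsto (fun t : ℝ => inner ℝ (g' u) (w - u) + t * (M / 2 * ‖w - u‖ ^ 2))
      (nhdsWithin 0 (Set.Ioi 0)) (nhds (inner ℝ (g' u) (w - u))) := by
    have : Continuous (fun t : ℝ => inner ℝ (g' u) (w - u) + t * (M / 2 * ‖w - u‖ ^ 2)) := by
      fun_prop
    simpa using (this.tendsto 0).mono_left nhdsWithin_le_nhds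
  refine ge_of_tendsto hlim ?_
  filter_upwards [Ioc_mem_nhdsGT (zero_lt_one' ℝ)] with t ht
  exact key t ht.1 ht.2

/-- Stability of solutions of strongly monotone variational inequalities on a fixed set. -/
lemma QuadBounds.norm_sub_le {h' : E → E} (h : QuadBounds g g' m M) {u v : E}
    (hu : IsStationary g' S u) (hv : IsStationary h' S v) :
    m * ‖u - v‖ ≤ ‖h' v - g' v‖ := by
  have h1 := h.strongMono u v
  have h2 := hu.2 v hv.1
  have h3 := hv.2 u hu.1
  have h4 := real_inner_le_norm (h' v - g' v) (u - v)
  rw [inner_sub_left] at h1 h4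
  rw [← neg_sub u v, inner_neg_right] at h2
  rcases (norm_nonneg (u - v)).eq_or_lt with h0 | h0
  · rw [← h0, mul_zero]; exact norm_nonneg _
  · refine le_of_mul_le_mul_right ?_ h0
    nlinarith

lemma QuadBounds.eq_of_isStationary (h : QuadBounds g g' m M) (hm : 0 < m) {u v : E}
    (hu : IsStationary g' S u) (hv : IsStationary g' S v) : u = v := by
  have h1 := h.norm_sub_le hu hv
  rw [sub_self, norm_zero] at h1
  have h2 : ‖u - v‖ ≤ 0 := by nlinarith [norm_nonneg (u - v)]
  exact sub_eq_zero.1 (norm_le_zero_iff.1 h2)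

end QuadBounds

/-! ### Smooth functions and their regularizations -/

/-- The descent lemma, with both signs. -/
lemma IsSmoothFun.quadBounds {n : ℕ} {L : ℝ} {f : Vec n → ℝ} (hf : IsSmoothFun L f) :
    QuadBounds f (gradient f) (-L) L := by
  intro u w
  set v := w - u with hv
  have hd : ∀ t : ℝ, HasDerivAt
      (fun t : ℝ => f (u + t • v) - f u - t * inner ℝ (gradient f u) v)
      (inner ℝ (gradient f (u + t • v) - gradient f u) v) t := by
    intro t
    have h1 : HasDerivAt (fun t : ℝ => u + t • v) v t := by
      simpa using ((hasDerivAt_id t).smul_const v).const_add u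
    have h2 := ((hf.1 (u + t • v)).hasGradientAt.hasFDerivAt).comp_hasDerivAt t h1
    have h3 := (h2.sub_const (f u)).sub
      ((hasDerivAt_id t).mul_const (inner ℝ (gradient f u) v))
    refine h3.congr_deriv ?_
    simp [inner_sub_left]
  have hB : ∀ t : ℝ, HasDerivAt (fun t : ℝ => L / 2 * ‖v‖ ^ 2 * t ^ 2) (L * ‖v‖ ^ 2 * t) t := by
    intro t
    refine ((hasDerivAt_pow 2 t).const_mul (L / 2 * ‖v‖ ^ 2)).congr_deriv ?_
    simp; ring
  have key := image_norm_le_of_norm_deriv_right_le_deriv_boundary (a := 0) (b := 1)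
    (f := fun t : ℝ => f (u + t • v) - f u - t * inner ℝ (gradient f u) v)
    (fun t _ => (hd t).continuousAt.continuousWithinAt)
    (fun t _ => (hd t).hasDerivWithinAt) (by simp) hB (by
      intro t ht
      have h1 := abs_real_inner_le_norm (gradient f (u + t • v) - gradient f u) v
      have h2 := hf.2 (u + t • v) u
      rw [add_sub_cancel_left, norm_smul, Real.norm_eq_abs, abs_of_nonneg ht.1] at h2
      rw [Real.norm_eq_abs]
      nlinarith [norm_nonneg v, mul_le_mul_of_nonneg_right h2 (norm_nonneg v)])
    (Set.right_mem_Icc.2 zero_le_one)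
  have e : u + v = w := by rw [hv]; abel
  simp only [one_smul, one_mul, one_pow, mul_one, Real.norm_eq_abs, e] at key
  have := abs_le.1 key
  constructor <;> nlinarith

section Regularized

variable {n m p : ℕ}

lemma norm_sq_expand {E : Type*} [NormedAddCommGroup E] [InnerProductSpace ℝ E] (a c : E) :
    ‖c‖ ^ 2 = ‖a‖ ^ 2 + 2 * inner ℝ a (c - a) + ‖c - a‖ ^ 2 := by
  have := norm_add_sq_real a (c - a)
  rwa [add_sub_cancel] at this

/-- The objective of the constrained proximal problem, `f + (κ/2) ‖· - z‖²`. -/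
def Problem.prox (Q : Problem n m p) (κ : ℝ) (z u : Vec n) : ℝ :=
  Q.f u + κ / 2 * ‖u - z‖ ^ 2

/-- The gradient of `Problem.prox`. -/
def Problem.proxGrad (Q : Problem n m p) (κ : ℝ) (z u : Vec n) : Vec n :=
  gradient Q.f u + κ • (u - z)

/-- The proximal augmented Lagrangian `K(u, y, z) = L_ρ(u, y) + (μ/2) ‖u - z‖²`. -/
def Problem.proxLag (Q : Problem n m p) (ρ μ : ℝ) (y : Vec m) (z u : Vec n) : ℝ :=
  Q.augLag ρ u y + μ / 2 * ‖u - z‖ ^ 2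

/-- The gradient of `Problem.proxLag` in `u`. -/
def Problem.lagGrad (Q : Problem n m p) (ρ μ : ℝ) (y : Vec m) (z u : Vec n) : Vec n :=
  gradient Q.f u + Q.A.adjoint y + ρ • Q.A.adjoint (Q.A u - Q.b) + μ • (u - z)

variable {Q : Problem n m p} {L : ℝ}

lemma Problem.quadBounds_prox (hf : IsSmoothFun L Q.f) (κ : ℝ) (z : Vec n) :
    QuadBounds (Q.prox κ z) (Q.proxGrad κ z) (κ - L) (κ + L) := by
  intro u w
  obtain ⟨h1, h2⟩ := hf.quadBounds u w
  have h3 := norm_sq_expand (u - z) (w - z)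
  rw [sub_sub_sub_cancel_right] at h3
  simp only [Problem.prox, Problem.proxGrad, inner_add_left, inner_smul_left, h3,
    RCLike.conj_to_real]
  constructor <;> nlinarith

lemma Problem.quadBounds_proxLag (hf : IsSmoothFun L Q.f) {ρ : ℝ} (hρ : 0 ≤ ρ) (μ : ℝ)
    (y : Vec m) (z : Vec n) :
    QuadBounds (Q.proxLag ρ μ y z) (Q.lagGrad ρ μ y z) (μ - L) (L + ρ * ‖Q.A‖ ^ 2 + μ) := by
  intro u w
  obtain ⟨h1, h2⟩ := hf.quadBounds u w
  have h3 := norm_sq_expand (u - z) (w - z)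
  rw [sub_sub_sub_cancel_right] at h3
  have h4 := norm_sq_expand (Q.A u - Q.b) (Q.A w - Q.b)
  rw [sub_sub_sub_cancel_right, ← map_sub] at h4
  have h5 : inner ℝ (Q.A w - Q.b) y = inner ℝ (Q.A u - Q.b) y + inner ℝ (Q.A (w - u)) y := by
    rw [← inner_add_left, map_sub]; congr 1; abel
  have h6 : ‖Q.A (w - u)‖ ^ 2 ≤ ‖Q.A‖ ^ 2 * ‖w - u‖ ^ 2 := by
    rw [← mul_pow]; gcongr; exact Q.A.le_opNorm _
  have h7 : 0 ≤ ρ * ‖Q.A (w - u)‖ ^ 2 := by positivity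
  have h8 := mul_le_mul_of_nonneg_left h6 hρ
  have h9 := real_inner_comm y (Q.A (w - u))
  simp only [Problem.proxLag, Problem.augLag, Problem.lagGrad, inner_add_left, inner_smul_left,
    h3, h4, h5, RCLike.conj_to_real, ContinuousLinearMap.adjoint_inner_left]
  constructor <;> nlinarith

lemma Problem.norm_lagGrad_sub_le (hf : IsSmoothFun L Q.f) {ρ μ : ℝ} (hρ : 0 ≤ ρ) (hμ : 0 ≤ μ)
    (y : Vec m) (z u w : Vec n) :
    ‖Q.lagGrad ρ μ y z u - Q.lagGrad ρ μ y z w‖ ≤ (L + ρ * ‖Q.A‖ ^ 2 + μ) * ‖u - w‖ := by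
  have e : Q.lagGrad ρ μ y z u - Q.lagGrad ρ μ y z w =
      (gradient Q.f u - gradient Q.f w) + ρ • Q.A.adjoint (Q.A (u - w)) + μ • (u - w) := by
    simp only [Problem.lagGrad, map_sub, smul_sub]; abel
  have h2 : ‖Q.A.adjoint (Q.A (u - w))‖ ≤ ‖Q.A‖ ^ 2 * ‖u - w‖ := by
    have h3 := Q.A.adjoint.le_opNorm (Q.A (u - w))
    have h4 := Q.A.le_opNorm (u - w)
    rw [LinearIsometryEquiv.norm_map] at h3
    nlinarith [norm_nonneg Q.A]
  rw [e]
  refine (norm_add₃_le).trans ?_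
  rw [norm_smul, norm_smul, Real.norm_of_nonneg hρ, Real.norm_of_nonneg hμ]
  have := mul_le_mul_of_nonneg_left h2 hρ
  linarith [hf.2 u w]

lemma Problem.isClosed_X (Q : Problem n m p) : IsClosed Q.X := by
  simp only [Problem.X, Set.ofPred_forall]
  refine isClosed_iInter fun i => isClosed_le ?_ continuous_const
  fun_prop

lemma Problem.convex_X (Q : Problem n m p) : Convex ℝ Q.X := by
  intro u hu w hw s t hs ht hst i
  have h1 := mul_le_mul_of_nonneg_left (hu i) hs
  have h2 := mul_le_mul_of_nonneg_left (hw i) ht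
  have : Q.h i = s * Q.h i + t * Q.h i := by rw [← add_mul, hst, one_mul]
  simp only [map_add, map_smul, PiLp.add_apply, PiLp.smul_apply, smul_eq_mul]
  linarith

lemma Problem.isClosed_feasible (Q : Problem n m p) : IsClosed Q.feasible :=
  Q.isClosed_X.inter (isClosed_eq Q.A.continuous continuous_const)

lemma Problem.convex_feasible (Q : Problem n m p) : Convex ℝ Q.feasible := by
  intro u hu w hw s t hs ht hst
  refine ⟨Q.convex_X hu.1 hw.1 hs ht hst, ?_⟩
  rw [map_add, map_smul, map_smul, hu.2, hw.2, ← add_smul, hst, one_smul]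

end Regularized

/-! ### Lipschitz dependence on the right-hand side -/

/-- A curve that is `C`-Lipschitz on each member of a finite closed cover of `[0, 1]` moves by at
most `C` in unit time. -/
lemma norm_sub_le_of_finite_closed_cover {E ι : Type*} [NormedAddCommGroup E] [Finite ι]
    {u : ℝ → E} {C : ℝ} {T : ι → Set ℝ} (hT : ∀ i, IsClosed (T i))
    (hcov : Set.Icc 0 1 ⊆ ⋃ i, T i)
    (hlip : ∀ i, ∀ s ∈ T i, ∀ t ∈ T i, ‖u s - u t‖ ≤ C * |s - t|) : ‖u 1 - u 0‖ ≤ C := by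
  have hcont : ContinuousOn u (Set.Icc 0 1) := by
    refine ContinuousOn.mono ?_ hcov
    refine LocallyFinite.continuousOn_iUnion (locallyFinite_of_finite T) hT fun i => ?_
    have : LipschitzOnWith (Real.toNNReal |C|) u (T i) := by
      refine LipschitzOnWith.of_dist_le_mul fun s hs t ht => ?_
      rw [dist_eq_norm, Real.dist_eq, Real.coe_toNNReal _ (abs_nonneg C)]
      exact (hlip i s hs t ht).trans (mul_le_mul_of_nonneg_right (le_abs_self C) (abs_nonneg _))
    exact this.continuousOn
  have hclosed : IsClosed ({t | ‖u t - u 0‖ ≤ C * t} ∩ Set.Icc 0 1) := by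
    have h := ContinuousOn.preimage_isClosed_of_isClosed
      (f := fun t => C * t - ‖u t - u 0‖) (t := Set.Ici 0)
      ((by fun_prop : Continuous fun t : ℝ => C * t).continuousOn.sub
        (hcont.sub continuousOn_const).norm) isClosed_Icc isClosed_Ici
    convert h using 1
    ext t
    simp [and_comm]
  have hsub := hclosed.Icc_subset_of_forall_exists_gt (by simp) fun x hx y hy => by
    -- close to `x`, only those members of the cover that contain `x` matter
    have hev : ∀ᶠ s in nhdsWithin x (Set.Ioi x), ∀ i, x ∉ T i → s ∉ T i := by
      rw [Filter.eventually_all]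
      intro i
      by_cases hi : x ∈ T i
      · simp [hi]
      · filter_upwards [nhdsWithin_le_nhds ((hT i).isOpen_compl.mem_nhds hi)] with s hs _ using hs
    have hlt : x < min y 1 := lt_min hy hx.2.2
    obtain ⟨s, hs, hsI⟩ := (hev.and (Ioc_mem_nhdsGT hlt)).exists
    have hs1 : s ≤ 1 := hsI.2.trans (min_le_right _ _)
    refine ⟨s, ?_, hsI.1, hsI.2.trans (min_le_left _ _)⟩
    obtain ⟨i, hi⟩ := Set.mem_iUnion.1 (hcov ⟨hx.2.1.trans hsI.1.le, hs1⟩)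
    have hxi : x ∈ T i := by
      by_contra h
      exact hs i h hi
    have h1 := hlip i s hi x hxi
    rw [abs_of_pos (sub_pos.2 hsI.1)] at h1
    have h2 : ‖u x - u 0‖ ≤ C * x := hx.1
    have h3 := norm_sub_le_norm_sub_add_norm_sub (u s) (u x) (u 0)
    show ‖u s - u 0‖ ≤ C * s
    linarith
  simpa using hsub (Set.right_mem_Icc.2 zero_le_one)

section Perturbation

variable {n m p : ℕ}

/-- The common kernel of `A` and of the rows of `H` with index in `I`. -/
def activeKer (A : Vec n →L[ℝ] Vec m) (H : Vec n →L[ℝ] Vec p) (I : Set (Fin p)) :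
    Submodule ℝ (Vec n) where
  carrier := {w | A w = 0 ∧ ∀ i ∈ I, H w i = 0}
  add_mem' := by
    intro u w hu hw
    refine ⟨by rw [map_add, hu.1, hw.1, add_zero], fun i hi => ?_⟩
    rw [map_add, PiLp.add_apply, hu.2 i hi, hw.2 i hi, add_zero]
  zero_mem' := ⟨map_zero _, fun i _ => by rw [map_zero]; rfl⟩
  smul_mem' := by
    intro c w hw
    refine ⟨by rw [map_smul, hw.1, smul_zero], fun i hi => ?_⟩
    rw [map_smul, PiLp.smul_apply, hw.2 i hi, smul_zero]

/-- `A` is bounded below, uniformly in the active set `I`, on the vectors that are annihilated by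
the active rows of `H` and orthogonal to the common kernel: there `A` is injective. -/
lemma exists_norm_le_of_mem_orthogonal (A : Vec n →L[ℝ] Vec m) (H : Vec n →L[ℝ] Vec p) :
    ∃ C : ℝ, 0 < C ∧ ∀ (I : Set (Fin p)) (w : Vec n), w ∈ (activeKer A H I)ᗮ →
      (∀ i ∈ I, H w i = 0) → ‖w‖ ≤ C * ‖A w‖ := by
  have hI : ∀ I : Set (Fin p), ∃ C : ℝ, 0 ≤ C ∧ ∀ w : Vec n, w ∈ (activeKer A H I)ᗮ →
      (∀ i ∈ I, H w i = 0) → ‖w‖ ≤ C * ‖A w‖ := by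
    intro I
    let N : Submodule ℝ (Vec n) := activeKer (0 : Vec n →L[ℝ] Vec m) H I ⊓ (activeKer A H I)ᗮ
    have hker : LinearMap.ker ((A : Vec n →ₗ[ℝ] Vec m).domRestrict N) = ⊥ := by
      rw [LinearMap.ker_eq_bot']
      rintro ⟨w, hw⟩ h0
      have h1 : w ∈ activeKer A H I := ⟨h0, hw.1.2⟩
      have h2 : inner ℝ w w = 0 := hw.2 w h1
      exact Subtype.ext (inner_self_eq_zero.1 h2)
    obtain ⟨K, -, hK⟩ := LinearMap.exists_antilipschitzWith _ hker
    refine ⟨K, K.2, fun w hw hw' => ?_⟩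
    have hmem : w ∈ N := ⟨⟨rfl, hw'⟩, hw⟩
    have := hK.le_mul_dist (⟨w, hmem⟩ : N) 0
    simpa [dist_eq_norm] using this
  choose C hC0 hC using hI
  refine ⟨1 + ∑ I, C I, add_pos_of_pos_of_nonneg one_pos (Finset.sum_nonneg fun I _ => hC0 I),
    fun I w hw hw' => (hC I w hw hw').trans ?_⟩
  refine mul_le_mul_of_nonneg_right ?_ (norm_nonneg _)
  have := Finset.single_le_sum (fun I _ => hC0 I) (Finset.mem_univ I)
  linarith

variable {A : Vec n →L[ℝ] Vec m} {H : Vec n →L[ℝ] Vec p}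

/-- The polyhedron `{u : H u ≤ h, A u = c}`. -/
def polyhedron (A : Vec n →L[ℝ] Vec m) (H : Vec n →L[ℝ] Vec p) (h : Vec p) (c : Vec m) :
    Set (Vec n) := {u | (∀ i, H u i ≤ h i) ∧ A u = c}

lemma isClosed_setOf_polyhedron (h : Vec p) (b r : Vec m) :
    IsClosed {q : ℝ × Vec n | q.2 ∈ polyhedron A H h (b + q.1 • r)} := by
  simp only [polyhedron, Set.mem_ofPred_eq]
  refine IsClosed.inter (s₁ := {q : ℝ × Vec n | ∀ i, H q.2 i ≤ h i})
    (s₂ := {q : ℝ × Vec n | A q.2 = b + q.1 • r}) ?_ (isClosed_eq (by fun_prop) (by fun_prop))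
  rw [Set.ofPred_forall]
  exact isClosed_iInter fun i => isClosed_le (by fun_prop) continuous_const

lemma combo_mem_polyhedron {h : Vec p} {b r : Vec m} {s t θ : ℝ} {u w : Vec n}
    (hu : u ∈ polyhedron A H h (b + s • r)) (hw : w ∈ polyhedron A H h (b + t • r))
    (h0 : 0 ≤ θ) (h1 : θ ≤ 1) :
    u + θ • (w - u) ∈ polyhedron A H h (b + (s + θ * (t - s)) • r) := by
  refine ⟨fun i => ?_, ?_⟩
  · have e1 := mul_le_mul_of_nonneg_left (hw.1 i) h0
    have e2 := mul_le_mul_of_nonneg_left (hu.1 i) (sub_nonneg.2 h1)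
    simp only [map_add, map_smul, map_sub, PiLp.add_apply, PiLp.smul_apply, PiLp.sub_apply,
      smul_eq_mul]
    linarith
  · rw [map_add, map_smul, map_sub, hu.2, hw.2]
    module

/-- Along a segment of right-hand sides, the polyhedra depend on the right-hand side in a lower
Lipschitz way, with a constant that may depend on the point `w`. -/
lemma exists_mem_polyhedron_near {h : Vec p} {b r : Vec m} {u₀ u₁ w : Vec n} {t : ℝ}
    (h₀ : u₀ ∈ polyhedron A H h (b + (0 : ℝ) • r)) (h₁ : u₁ ∈ polyhedron A H h (b + (1 : ℝ) • r))
    (hw : w ∈ polyhedron A H h (b + t • r)) (ht : t ∈ Set.Icc (0 : ℝ) 1) :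
    ∃ c : ℝ, ∀ s ∈ Set.Icc (0 : ℝ) 1, ∃ v ∈ polyhedron A H h (b + s • r),
      ‖v - w‖ ≤ c * |s - t| := by
  refine ⟨‖u₀ - w‖ / t + ‖u₁ - w‖ / (1 - t), fun s hs => ?_⟩
  have hn0 : 0 ≤ ‖u₀ - w‖ / t := div_nonneg (norm_nonneg _) ht.1
  have hn1 : 0 ≤ ‖u₁ - w‖ / (1 - t) := div_nonneg (norm_nonneg _) (sub_nonneg.2 ht.2)
  rcases lt_trichotomy s t with hst | rfl | hst
  · have htpos : 0 < t := hs.1.trans_lt hst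
    have hmem := combo_mem_polyhedron hw h₀ (θ := (t - s) / t)
      (div_nonneg (sub_nonneg.2 hst.le) htpos.le) ((div_le_one htpos).2 (by linarith [hs.1]))
    have e : t + (t - s) / t * (0 - t) = s := by field_simp; ring
    rw [e] at hmem
    refine ⟨_, hmem, ?_⟩
    rw [add_sub_cancel_left, norm_smul, abs_of_neg (sub_neg.2 hst), Real.norm_of_nonneg
      (div_nonneg (sub_nonneg.2 hst.le) htpos.le)]
    have e2 : (t - s) / t * ‖u₀ - w‖ = ‖u₀ - w‖ / t * (t - s) := by ring
    rw [e2, neg_sub]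
    exact mul_le_mul_of_nonneg_right (by linarith) (by linarith)
  · exact ⟨w, hw, by simp⟩
  · have htpos : 0 < 1 - t := by linarith [hs.2]
    have hmem := combo_mem_polyhedron hw h₁ (θ := (s - t) / (1 - t))
      (div_nonneg (sub_nonneg.2 hst.le) htpos.le) ((div_le_one htpos).2 (by linarith [hs.2]))
    have e : t + (s - t) / (1 - t) * (1 - t) = s := by field_simp; ring
    rw [e] at hmem
    refine ⟨_, hmem, ?_⟩
    rw [add_sub_cancel_left, norm_smul, abs_of_pos (sub_pos.2 hst), Real.norm_of_nonneg
      (div_nonneg (sub_nonneg.2 hst.le) htpos.le)]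
    have e2 : (s - t) / (1 - t) * ‖u₁ - w‖ = ‖u₁ - w‖ / (1 - t) * (s - t) := by ring
    rw [e2]
    exact mul_le_mul_of_nonneg_right (by linarith) (by linarith)

/-- At a stationary point the gradient is orthogonal to the common kernel of `A` and of the active
rows of `H`: one can move both ways along this kernel without leaving the polyhedron. -/
lemma IsStationary.mem_orthogonal_activeKer {g' : Vec n → Vec n} {h : Vec p} {c : Vec m}
    {u : Vec n} (hu : IsStationary g' (polyhedron A H h c) u) :
    g' u ∈ (activeKer A H {i | H u i = h i})ᗮ := by
  rw [Submodule.mem_orthogonal']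
  intro w hw
  have hev : ∀ᶠ t in nhds (0 : ℝ), ∀ i, H (u + t • w) i ≤ h i := by
    rw [Filter.eventually_all]
    intro i
    by_cases hi : H u i = h i
    · refine Filter.Eventually.of_forall fun t => ?_
      simp [hi, hw.2 i hi]
    · have hlt : H (u + (0 : ℝ) • w) i < h i := by
        simpa using lt_of_le_of_ne (hu.1.1 i) hi
      have hc : Continuous fun t : ℝ => H (u + t • w) i := by fun_prop
      filter_upwards [hc.continuousAt.eventually_lt continuousAt_const hlt] with t ht using ht.le
  obtain ⟨ε, hε, hball⟩ := Metric.eventually_nhds_iff.1 hev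
  have hmem : ∀ t : ℝ, |t| < ε → 0 ≤ t * inner ℝ (g' u) w := by
    intro t ht
    have h1 : u + t • w ∈ polyhedron A H h c :=
      ⟨hball (by simpa using ht), by rw [map_add, map_smul, hw.1, smul_zero, add_zero, hu.1.2]⟩
    have h2 := hu.2 _ h1
    rwa [add_sub_cancel_left, inner_smul_right] at h2
  have h1 := hmem (ε / 2) (by rw [abs_of_pos (by positivity)]; linarith)
  have h2 := hmem (-(ε / 2)) (by rw [abs_neg, abs_of_pos (by positivity)]; linarith)
  have h3 : ε / 2 * inner ℝ (g' u) w = 0 := by linarith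
  exact (mul_eq_zero.1 h3).resolve_left (by positivity)

/-- If the same index set `I` certifies stationarity of `u` and `v` for the right-hand sides `c`
and `c'`, then `‖u - v‖` is bounded by a multiple of `‖c - c'‖`. -/
lemma norm_sub_le_of_common_active {g : Vec n → ℝ} {g' : Vec n → Vec n} {k M Lg C : ℝ}
    (hg : QuadBounds g g' k M)
    (hlip : ∀ u v, ‖g' u - g' v‖ ≤ Lg * ‖u - v‖)
    (hC : ∀ (I : Set (Fin p)) (w : Vec n), w ∈ (activeKer A H I)ᗮ →
      (∀ i ∈ I, H w i = 0) → ‖w‖ ≤ C * ‖A w‖)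
    {I : Set (Fin p)} {u v : Vec n} (hu : g' u ∈ (activeKer A H I)ᗮ)
    (hv : g' v ∈ (activeKer A H I)ᗮ) (huv : ∀ i ∈ I, H u i = H v i) :
    k * ‖u - v‖ ≤ Lg * C * ‖A u - A v‖ := by
  set N := activeKer A H I with hN
  obtain ⟨y, hy, z, hz, hyz⟩ := N.exists_add_mem_mem_orthogonal (u - v)
  have hAz : A z = A u - A v := by
    have := congrArg A hyz
    rw [map_sub, map_add, hy.1, zero_add] at this
    exact this.symm
  have hHz : ∀ i ∈ I, H z i = 0 := by
    intro i hi
    have := congrArg (fun q => H q i) hyz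
    simp only [map_sub, map_add, PiLp.add_apply, PiLp.sub_apply, hy.2 i hi, zero_add,
      huv i hi, sub_self] at this
    exact this.symm
  have h1 := hg.strongMono u v
  have h2 : inner ℝ (g' u - g' v) y = 0 :=
    (Submodule.mem_orthogonal' N _).1 (N.orthogonal.sub_mem hu hv) y hy
  have h3 : inner ℝ (g' u - g' v) (u - v) = inner ℝ (g' u - g' v) z := by
    rw [hyz, inner_add_right, h2, zero_add]
  have h4 := real_inner_le_norm (g' u - g' v) z
  have h5 := hC I z hz hHz
  rw [hAz] at h5
  rcases (norm_nonneg (u - v)).eq_or_lt with h0 | h0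
  · have hL : 0 ≤ Lg * C * ‖A u - A v‖ := by
      have : u = v := sub_eq_zero.1 (norm_eq_zero.1 h0.symm)
      simp [this]
    rw [← h0, mul_zero]
    exact hL
  · refine le_of_mul_le_mul_right ?_ h0
    have hL : 0 ≤ Lg * ‖u - v‖ := (norm_nonneg _).trans (hlip u v)
    calc k * ‖u - v‖ * ‖u - v‖ = k * ‖u - v‖ ^ 2 := by ring
      _ ≤ ‖g' u - g' v‖ * ‖z‖ := by rw [h3] at h1; exact h1.trans h4
      _ ≤ (Lg * ‖u - v‖) * (C * ‖A u - A v‖) :=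
        mul_le_mul (hlip u v) h5 (norm_nonneg _) hL
      _ = Lg * C * ‖A u - A v‖ * ‖u - v‖ := by ring

/-- Minimizers over `{u : H u ≤ h, A u = c}` depend on `c` in a Lipschitz way, with a constant
independent of `h`. Along the segment of right-hand sides between the two given ones, the curve of
minimizers is Lipschitz on each of the finitely many closed sets of parameters on which a given
index set certifies stationarity. -/
lemma norm_sub_le_of_polyhedron {g : Vec n → ℝ} {g' : Vec n → Vec n} {k M Lg C : ℝ}
    (hg : QuadBounds g g' k M) (hk : 0 < k)
    (hlip : ∀ u v, ‖g' u - g' v‖ ≤ Lg * ‖u - v‖)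
    (hC : ∀ (I : Set (Fin p)) (w : Vec n), w ∈ (activeKer A H I)ᗮ →
      (∀ i ∈ I, H w i = 0) → ‖w‖ ≤ C * ‖A w‖)
    {h : Vec p} {c₀ c₁ : Vec m} {x₀ x₁ : Vec n}
    (h₀ : IsStationary g' (polyhedron A H h c₀) x₀)
    (h₁ : IsStationary g' (polyhedron A H h c₁) x₁) :
    ‖x₁ - x₀‖ ≤ Lg * C / k * ‖c₁ - c₀‖ := by
  set r := c₁ - c₀ with hr
  have e0 : c₀ + (0 : ℝ) • r = c₀ := by simp
  have e1 : c₀ + (1 : ℝ) • r = c₁ := by simp [hr]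
  rw [← e0] at h₀
  rw [← e1] at h₁
  have hgc : Continuous g' := by
    have : LipschitzWith (Real.toNNReal |Lg|) g' := by
      refine LipschitzWith.of_dist_le_mul fun s t => ?_
      rw [dist_eq_norm, dist_eq_norm, Real.coe_toNNReal _ (abs_nonneg Lg)]
      exact (hlip s t).trans (mul_le_mul_of_nonneg_right (le_abs_self Lg) (norm_nonneg _))
    exact this.continuous
  have hconv : ∀ t : ℝ, Convex ℝ (polyhedron A H h (c₀ + t • r)) := by
    intro t u hu w hw a b' ha hb hab
    have := combo_mem_polyhedron hu hw hb (by linarith)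
    have e : a • u + b' • w = u + b' • (w - u) := by
      rw [show a = 1 - b' by linarith]; module
    rw [e]
    simpa using this
  have hclosed := isClosed_setOf_polyhedron (A := A) (H := H) h c₀ r
  have hex : ∀ t : ℝ, ∃ u, t ∈ Set.Icc (0 : ℝ) 1 →
      IsStationary g' (polyhedron A H h (c₀ + t • r)) u := by
    intro t
    by_cases ht : t ∈ Set.Icc (0 : ℝ) 1
    · have hne := combo_mem_polyhedron h₀.1 h₁.1 ht.1 ht.2
      rw [sub_zero, mul_one, zero_add] at hne
      have hcl : IsClosed (polyhedron A H h (c₀ + t • r)) :=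
        hclosed.preimage (f := fun u : Vec n => (t, u)) (by fun_prop)
      obtain ⟨u, hu, hmin⟩ := hg.exists_isMinOn hk hcl ⟨_, hne⟩
      exact ⟨u, fun _ => hg.isStationary (hconv t) hu hmin⟩
    · exact ⟨0, fun h => absurd h ht⟩
  choose u hu using hex
  have hu0 : u 0 = x₀ := hg.eq_of_isStationary hk (hu 0 (by simp)) h₀
  have hu1 : u 1 = x₁ := hg.eq_of_isStationary hk (hu 1 (by simp)) h₁
  let T : Set (Fin p) → Set ℝ := fun I =>
    {t | t ∈ Set.Icc (0 : ℝ) 1 ∧ (∀ i ∈ I, H (u t) i = h i) ∧ g' (u t) ∈ (activeKer A H I)ᗮ}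
  have hTlip : ∀ I, ∀ s ∈ T I, ∀ t ∈ T I, ‖u s - u t‖ ≤ Lg * C / k * ‖r‖ * |s - t| := by
    intro I s hs t ht
    have key := norm_sub_le_of_common_active hg hlip hC hs.2.2 ht.2.2
      (fun i hi => by rw [hs.2.1 i hi, ht.2.1 i hi])
    have e : A (u s) - A (u t) = (s - t) • r := by
      rw [(hu s hs.1).1.2, (hu t ht.1).1.2]; module
    rw [e, norm_smul, Real.norm_eq_abs, mul_comm k, ← le_div_iff₀ hk] at key
    exact key.trans_eq (by ring)
  have hTclosed : ∀ I, IsClosed (T I) := by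
    intro I
    refine IsSeqClosed.isClosed fun t τ ht hτ => ?_
    have hτI : τ ∈ Set.Icc (0 : ℝ) 1 := isClosed_Icc.mem_of_tendsto hτ
      (Filter.Eventually.of_forall fun j => (ht j).1)
    have hcauchy : CauchySeq fun j => u (t j) := by
      have hlipT : LipschitzOnWith (Real.toNNReal |Lg * C / k * ‖r‖|) u (T I) := by
        refine LipschitzOnWith.of_dist_le_mul fun s hs t ht => ?_
        rw [dist_eq_norm, Real.dist_eq, Real.coe_toNNReal _ (abs_nonneg _)]
        exact (hTlip I s hs t ht).trans
          (mul_le_mul_of_nonneg_right (le_abs_self _) (abs_nonneg _))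
      exact hlipT.cauchySeq_comp hτ.cauchySeq (Set.range_subset_iff.2 ht)
    obtain ⟨v, hv⟩ := cauchySeq_tendsto_of_complete hcauchy
    have hvS : v ∈ polyhedron A H h (c₀ + τ • r) :=
      hclosed.mem_of_tendsto (hτ.prodMk_nhds hv)
        (Filter.Eventually.of_forall fun j => (hu (t j) (ht j).1).1)
    have hvst : IsStationary g' (polyhedron A H h (c₀ + τ • r)) v := by
      refine ⟨hvS, fun w hw => ?_⟩
      obtain ⟨c, hc⟩ := exists_mem_polyhedron_near h₀.1 h₁.1 hw hτI
      choose w' hw' hwc using fun j => hc (t j) (ht j).1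
      have hlim : Filter.Tendsto w' Filter.atTop (nhds w) := by
        rw [tendsto_iff_norm_sub_tendsto_zero]
        have h5 : Filter.Tendsto (fun j => c * |t j - τ|) Filter.atTop (nhds 0) := by
          have := ((hτ.sub_const τ).abs).const_mul c
          simpa using this
        exact squeeze_zero (fun j => norm_nonneg _) hwc h5
      exact ge_of_tendsto (((hgc.tendsto v).comp hv).inner (hlim.sub hv))
        (Filter.Eventually.of_forall fun j => (hu (t j) (ht j).1).2 _ (hw' j))
    have hvu : v = u τ := hg.eq_of_isStationary hk hvst (hu τ hτI)
    refine ⟨hτI, fun i hi => ?_, ?_⟩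
    · rw [← hvu]
      have hcH : Continuous fun q : Vec n => H q i := by fun_prop
      exact tendsto_nhds_unique ((hcH.tendsto v).comp hv)
        (tendsto_const_nhds.congr fun j => ((ht j).2.1 i hi).symm)
    · rw [← hvu]
      exact (Submodule.isClosed_orthogonal (activeKer A H I)).mem_of_tendsto
        ((hgc.tendsto v).comp hv) (Filter.Eventually.of_forall fun j => (ht j).2.2)
  have hcov : Set.Icc (0 : ℝ) 1 ⊆ ⋃ I, T I := fun t ht => Set.mem_iUnion.2
    ⟨{i | H (u t) i = h i}, ht, fun i hi => hi, (hu t ht).mem_orthogonal_activeKer⟩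
  have := norm_sub_le_of_finite_closed_cover hTclosed hcov hTlip
  rwa [hu0, hu1] at this

end Perturbation

/-! ### The global error bound -/

lemma muParam_pos (Lf : ℝ) : 0 < muParam Lf := lt_of_lt_of_le two_pos (le_max_left _ _)

lemma two_le_muParam (Lf : ℝ) : 2 ≤ muParam Lf := le_max_left _ _

lemma four_mul_le_muParam (Lf : ℝ) : 4 * Lf ≤ muParam Lf := le_max_right _ _

lemma muParam_sub_pos (Lf : ℝ) : 0 < muParam Lf - Lf := by
  linarith [two_le_muParam Lf, four_mul_le_muParam Lf]

/-- The minimizer `x` of the proximal augmented Lagrangian over `X` also minimizes the proximal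
function over `{u ∈ X : A u = A x}`, since the two functions differ by a constant there. The error
bound thus expresses the Lipschitz dependence of minimizers on the right-hand side of `A u = b`. -/
theorem exists_isErrorBound {n m p : ℕ} (A : Vec n →L[ℝ] Vec m) (H : Vec n →L[ℝ] Vec p)
    {Lf : ℝ} (hLf : 0 ≤ Lf) (ρ : ℝ) :
    ∃ σbar : ℝ, 0 < σbar ∧ ∀ Q : Problem n m p, Q.A = A → Q.H = H → IsSmoothFun Lf Q.f →
      Q.IsErrorBound ρ (muParam Lf) σbar := by
  obtain ⟨C, hC0, hC⟩ := exists_norm_le_of_mem_orthogonal A H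
  have hμ := muParam_pos Lf
  have hk := muParam_sub_pos Lf
  refine ⟨(Lf + muParam Lf) * C / (muParam Lf - Lf), by positivity, ?_⟩
  rintro Q rfl rfl hf y z x xbar hx hmin hxb hminb
  have hg := Problem.quadBounds_prox (Q := Q) hf (muParam Lf) z
  have hlip : ∀ u v, ‖Q.proxGrad (muParam Lf) z u - Q.proxGrad (muParam Lf) z v‖ ≤
      (Lf + muParam Lf) * ‖u - v‖ := by
    intro u v
    have e : Q.proxGrad (muParam Lf) z u - Q.proxGrad (muParam Lf) z v =
        (gradient Q.f u - gradient Q.f v) + muParam Lf • (u - v) := by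
      simp only [Problem.proxGrad, smul_sub]; abel
    rw [e]
    refine (norm_add_le _ _).trans ?_
    rw [norm_smul, Real.norm_of_nonneg hμ.le]
    linarith [hf.2 u v]
  have hconv : ∀ c, Convex ℝ (polyhedron Q.A Q.H Q.h c) := fun c =>
    ({ Q with b := c } : Problem n m p).convex_feasible
  have h0 : IsStationary (Q.proxGrad (muParam Lf) z) (polyhedron Q.A Q.H Q.h Q.b) xbar :=
    hg.isStationary (hconv _) hxb hminb
  have h1 : IsStationary (Q.proxGrad (muParam Lf) z) (polyhedron Q.A Q.H Q.h (Q.A x)) x := by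
    refine hg.isStationary (hconv _) ⟨hx, rfl⟩ fun u hu => ?_
    have h2 := hmin hu.1
    have h3 : Q.A u = Q.A x := hu.2
    simp only [Set.mem_ofPred_eq, Problem.augLag, h3] at h2
    show Q.f x + _ ≤ Q.f u + _
    linarith
  exact norm_sub_le_of_polyhedron hg hk hlip hC h0 h1

/-! ### Proximal points and the Moreau envelope -/

section Minimizers

variable {n m p : ℕ} {Q : Problem n m p} {L ρ μ κ : ℝ}

/-- A minimizer of `g` over `S` (arbitrary if there is none). -/
def argminOn {E : Type*} [Nonempty E] (g : E → ℝ) (S : Set E) : E :=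
  Classical.epsilon fun u => u ∈ S ∧ IsMinOn g S u

/-- The primal proximal point: the minimizer of `f + (κ/2) ‖· - z‖²` over the feasible set. -/
def Problem.xBar (Q : Problem n m p) (κ : ℝ) (z : Vec n) : Vec n :=
  argminOn (Q.prox κ z) Q.feasible

/-- The minimizer of the proximal augmented Lagrangian over `X`. -/
def Problem.xStar (Q : Problem n m p) (ρ μ : ℝ) (y : Vec m) (z : Vec n) : Vec n :=
  argminOn (Q.proxLag ρ μ y z) Q.X

lemma Problem.xBar_spec (hf : IsSmoothFun L Q.f) (hκ : L < κ) (hne : Q.feasible.Nonempty)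
    (z : Vec n) : Q.xBar κ z ∈ Q.feasible ∧ IsMinOn (Q.prox κ z) Q.feasible (Q.xBar κ z) :=
  Classical.epsilon_spec ((Problem.quadBounds_prox hf κ z).exists_isMinOn (sub_pos.2 hκ)
    Q.isClosed_feasible hne)

lemma Problem.xBar_isStationary (hf : IsSmoothFun L Q.f) (hκ : L < κ)
    (hne : Q.feasible.Nonempty) (z : Vec n) :
    IsStationary (Q.proxGrad κ z) Q.feasible (Q.xBar κ z) :=
  (Problem.quadBounds_prox hf κ z).isStationary Q.convex_feasible
    (Problem.xBar_spec hf hκ hne z).1 (Problem.xBar_spec hf hκ hne z).2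

lemma Problem.xStar_spec (hf : IsSmoothFun L Q.f) (hρ : 0 ≤ ρ) (hμ : L < μ)
    (hne : Q.feasible.Nonempty) (y : Vec m) (z : Vec n) :
    Q.xStar ρ μ y z ∈ Q.X ∧ IsMinOn (Q.proxLag ρ μ y z) Q.X (Q.xStar ρ μ y z) :=
  Classical.epsilon_spec ((Problem.quadBounds_proxLag hf hρ μ y z).exists_isMinOn (sub_pos.2 hμ)
    Q.isClosed_X ⟨_, hne.some_mem.1⟩)

lemma Problem.xStar_isStationary (hf : IsSmoothFun L Q.f) (hρ : 0 ≤ ρ) (hμ : L < μ)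
    (hne : Q.feasible.Nonempty) (y : Vec m) (z : Vec n) :
    IsStationary (Q.lagGrad ρ μ y z) Q.X (Q.xStar ρ μ y z) :=
  (Problem.quadBounds_proxLag hf hρ μ y z).isStationary Q.convex_X
    (Problem.xStar_spec hf hρ hμ hne y z).1 (Problem.xStar_spec hf hρ hμ hne y z).2

lemma Problem.norm_xBar_sub_le (hf : IsSmoothFun L Q.f) (hκ : L < κ) (hκ0 : 0 ≤ κ)
    (hne : Q.feasible.Nonempty) (z z' : Vec n) :
    (κ - L) * ‖Q.xBar κ z - Q.xBar κ z'‖ ≤ κ * ‖z - z'‖ := by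
  refine ((Problem.quadBounds_prox hf κ z).norm_sub_le (Problem.xBar_isStationary hf hκ hne z)
    (Problem.xBar_isStationary hf hκ hne z')).trans_eq ?_
  have e : Q.proxGrad κ z' (Q.xBar κ z') - Q.proxGrad κ z (Q.xBar κ z') = κ • (z - z') := by
    simp only [Problem.proxGrad]; module
  rw [e, norm_smul, Real.norm_of_nonneg hκ0]

lemma Problem.norm_xStar_sub_le (hf : IsSmoothFun L Q.f) (hρ : 0 ≤ ρ) (hμ : L < μ) (hμ0 : 0 ≤ μ)
    (hne : Q.feasible.Nonempty) (y y' : Vec m) (z z' : Vec n) :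
    (μ - L) * ‖Q.xStar ρ μ y z - Q.xStar ρ μ y' z'‖ ≤ ‖Q.A‖ * ‖y - y'‖ + μ * ‖z - z'‖ := by
  refine ((Problem.quadBounds_proxLag hf hρ μ y z).norm_sub_le
    (Problem.xStar_isStationary hf hρ hμ hne y z)
    (Problem.xStar_isStationary hf hρ hμ hne y' z')).trans ?_
  have e : Q.lagGrad ρ μ y' z' (Q.xStar ρ μ y' z') - Q.lagGrad ρ μ y z (Q.xStar ρ μ y' z') =
      Q.A.adjoint (y' - y) + μ • (z - z') := by
    simp only [Problem.lagGrad, map_sub]; module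
  rw [e]
  refine (norm_add_le _ _).trans ?_
  rw [norm_smul, Real.norm_of_nonneg hμ0]
  have := Q.A.adjoint.le_opNorm (y' - y)
  rw [LinearIsometryEquiv.norm_map, norm_sub_rev] at this
  linarith

lemma Problem.continuous_xBar (hf : IsSmoothFun L Q.f) (hκ : L < κ) (hκ0 : 0 ≤ κ)
    (hne : Q.feasible.Nonempty) : Continuous (Q.xBar κ) := by
  have hk := sub_pos.2 hκ
  have : LipschitzWith (Real.toNNReal (κ / (κ - L))) (Q.xBar κ) := by
    refine LipschitzWith.of_dist_le_mul fun z z' => ?_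
    rw [dist_eq_norm, dist_eq_norm, Real.coe_toNNReal _ (by positivity), div_mul_eq_mul_div,
      le_div_iff₀ hk, mul_comm]
    exact Problem.norm_xBar_sub_le hf hκ hκ0 hne z z'
  exact this.continuous

lemma Problem.continuous_xStar (hf : IsSmoothFun L Q.f) (hρ : 0 ≤ ρ) (hμ : L < μ) (hμ0 : 0 ≤ μ)
    (hne : Q.feasible.Nonempty) : Continuous fun q : Vec m × Vec n => Q.xStar ρ μ q.1 q.2 := by
  have hk := sub_pos.2 hμ
  have : LipschitzWith (Real.toNNReal ((‖Q.A‖ + μ) / (μ - L)))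
      fun q : Vec m × Vec n => Q.xStar ρ μ q.1 q.2 := by
    refine LipschitzWith.of_dist_le_mul fun q q' => ?_
    rw [dist_eq_norm, Real.coe_toNNReal _ (by positivity), div_mul_eq_mul_div,
      le_div_iff₀ hk, mul_comm]
    refine (Problem.norm_xStar_sub_le hf hρ hμ hμ0 hne q.1 q'.1 q.2 q'.2).trans ?_
    have h1 : ‖q.1 - q'.1‖ ≤ dist q q' := by
      rw [← dist_eq_norm, Prod.dist_eq]; exact le_max_left _ _
    have h2 : ‖q.2 - q'.2‖ ≤ dist q q' := by
      rw [← dist_eq_norm, Prod.dist_eq]; exact le_max_right _ _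
    rw [add_mul]
    gcongr
  exact this.continuous

lemma Problem.envelope_eq (hf : IsSmoothFun L Q.f) (hκ : L < κ) (hne : Q.feasible.Nonempty)
    (z : Vec n) : Q.envelope κ z = Q.prox κ z (Q.xBar κ z) := by
  obtain ⟨h1, h2⟩ := Problem.xBar_spec hf hκ hne z
  have : Nonempty Q.feasible := ⟨⟨_, h1⟩⟩
  refine le_antisymm (ciInf_le ⟨Q.prox κ z (Q.xBar κ z), ?_⟩ (⟨_, h1⟩ : Q.feasible))
    (le_ciInf fun x => h2 x.2)
  rintro _ ⟨x, rfl⟩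
  exact h2 x.2

/-- The change of the proximal function in its centre. -/
lemma prox_sub_prox (Q : Problem n m p) (κ : ℝ) (z z' u : Vec n) :
    Q.prox κ z' u - Q.prox κ z u = κ * inner ℝ (z' - z) (z - u) + κ / 2 * ‖z' - z‖ ^ 2 := by
  have h := norm_sq_expand (u - z) (u - z')
  rw [sub_sub_sub_cancel_left] at h
  have e : inner ℝ (u - z) (z - z') = inner ℝ (z' - z) (z - u) := by
    rw [← neg_sub z u, ← neg_sub z' z, inner_neg_neg, real_inner_comm]
  simp only [Problem.prox, h, e, norm_sub_rev z z']
  ring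

/-- First-order upper bound for the envelope, from the minimizer at `z` as a competitor at `z'`. -/
lemma Problem.envelope_sub_le (hf : IsSmoothFun L Q.f) (hκ : L < κ)
    (hne : Q.feasible.Nonempty) (z z' : Vec n) :
    Q.envelope κ z' - Q.envelope κ z ≤
      κ * inner ℝ (z' - z) (z - Q.xBar κ z) + κ / 2 * ‖z' - z‖ ^ 2 := by
  rw [Problem.envelope_eq hf hκ hne, Problem.envelope_eq hf hκ hne, ← prox_sub_prox Q]
  have := (Problem.xBar_spec hf hκ hne z').2 (Problem.xBar_spec hf hκ hne z).1
  exact sub_le_sub_right this _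

/-- The Moreau envelope is differentiable, with gradient `κ (z - x̄(z))`: comparing the proximal
problems at `z` and `z'` through each other's minimizers bounds the first-order error by a multiple
of `‖z' - z‖²`. -/
lemma Problem.hasGradientAt_envelope (hf : IsSmoothFun L Q.f) (hκ : L < κ) (hκ0 : 0 ≤ κ)
    (hne : Q.feasible.Nonempty) (z : Vec n) :
    HasGradientAt (Q.envelope κ) (κ • (z - Q.xBar κ z)) z := by
  have hk := sub_pos.2 hκ
  rw [hasGradientAt_iff_isLittleO]
  have hO : (fun z' => Q.envelope κ z' - Q.envelope κ z -
      inner ℝ (κ • (z - Q.xBar κ z)) (z' - z)) =O[nhds z] fun z' => ‖z' - z‖ ^ 2 := by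
    refine Asymptotics.IsBigO.of_bound (κ / 2 + κ * (κ / (κ - L))) (Filter.Eventually.of_forall
      fun z' => ?_)
    have h1 := Problem.envelope_sub_le hf hκ hne z z'
    have h2 := Problem.envelope_sub_le hf hκ hne z' z
    have h3 := Problem.norm_xBar_sub_le hf hκ hκ0 hne z' z
    rw [mul_comm, ← le_div_iff₀ hk] at h3
    have e1 : inner ℝ (κ • (z - Q.xBar κ z)) (z' - z) =
        κ * inner ℝ (z' - z) (z - Q.xBar κ z) := by
      rw [inner_smul_left, RCLike.conj_to_real, real_inner_comm]
    have e2 : inner ℝ (z - z') (z' - Q.xBar κ z') = - (inner ℝ (z' - z) (z - Q.xBar κ z) +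
        ‖z' - z‖ ^ 2 - inner ℝ (z' - z) (Q.xBar κ z' - Q.xBar κ z)) := by
      rw [← neg_sub z' z, inner_neg_left, ← real_inner_self_eq_norm_sq, ← inner_add_right,
        ← inner_sub_right]
      congr 2; abel
    have h4 := real_inner_le_norm (z' - z) (Q.xBar κ z' - Q.xBar κ z)
    have h5 : inner ℝ (z' - z) (Q.xBar κ z' - Q.xBar κ z) ≤ κ / (κ - L) * ‖z' - z‖ ^ 2 := by
      refine h4.trans ((mul_le_mul_of_nonneg_left h3 (norm_nonneg _)).trans_eq (by ring))
    have h6 := mul_le_mul_of_nonneg_left h5 hκ0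
    have h7 : 0 ≤ κ * (κ / (κ - L)) * ‖z' - z‖ ^ 2 := by positivity
    have h8 : 0 ≤ κ * ‖z' - z‖ ^ 2 := by positivity
    rw [e2, norm_sub_rev z z'] at h2
    rw [e1, Real.norm_eq_abs, Real.norm_of_nonneg (by positivity), abs_le]
    constructor <;> nlinarith
  refine hO.trans_isLittleO ?_
  have h0 : Filter.Tendsto (fun z' : Vec n => z' - z) (nhds z) (nhds 0) := by
    have : Continuous fun z' : Vec n => z' - z := by fun_prop
    simpa using this.tendsto z
  exact (Asymptotics.isLittleO_norm_pow_id one_lt_two).comp_tendsto h0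

lemma Problem.differentiable_envelope (hf : IsSmoothFun L Q.f) (hκ : L < κ) (hκ0 : 0 ≤ κ)
    (hne : Q.feasible.Nonempty) : Differentiable ℝ (Q.envelope κ) := fun z =>
  (Problem.hasGradientAt_envelope hf hκ hκ0 hne z).hasFDerivAt.differentiableAt

lemma Problem.gradient_envelope (hf : IsSmoothFun L Q.f) (hκ : L < κ) (hκ0 : 0 ≤ κ)
    (hne : Q.feasible.Nonempty) (z : Vec n) :
    gradient (Q.envelope κ) z = κ • (z - Q.xBar κ z) :=
  (Problem.hasGradientAt_envelope hf hκ hκ0 hne z).gradient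

/-- The distance to the proximal point decreases when the proximal weight grows: add the two
minimality inequalities. -/
lemma Problem.norm_sub_xBar_le (hf : IsSmoothFun L Q.f) (hμ : L < μ) (hκ : μ ≤ κ)
    (hne : Q.feasible.Nonempty) (z : Vec n) : ‖z - Q.xBar κ z‖ ≤ ‖z - Q.xBar μ z‖ := by
  rcases hκ.eq_or_lt with rfl | hlt
  · exact le_rfl
  obtain ⟨h1, h2⟩ := Problem.xBar_spec hf hμ hne z
  obtain ⟨h3, h4⟩ := Problem.xBar_spec hf (hμ.trans hlt) hne z
  have h5 := h2 h3
  have h6 := h4 h1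
  simp only [Set.mem_ofPred_eq, Problem.prox] at h5 h6
  rw [norm_sub_rev z, norm_sub_rev z]
  refine le_of_sq_le_sq ?_ (norm_nonneg _)
  nlinarith

end Minimizers

/-! ### Projection onto `X` -/

section Proj

variable {n : ℕ} {S : Set (Vec n)}

lemma proj_spec (hS : IsClosed S) (hc : Convex ℝ S) (hne : S.Nonempty) (v : Vec n) :
    proj S v ∈ S ∧ ∀ w ∈ S, inner ℝ (v - proj S v) (w - proj S v) ≤ 0 := by
  have hex : ∃ q, q ∈ S ∧ ∀ w ∈ S, ‖v - q‖ ≤ ‖v - w‖ := by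
    obtain ⟨q, hq, h⟩ := hS.exists_infDist_eq_dist hne v
    refine ⟨q, hq, fun w hw => ?_⟩
    rw [← dist_eq_norm, ← dist_eq_norm, ← h]
    exact Metric.infDist_le_dist_of_mem hw
  obtain ⟨h1, h2⟩ := Classical.epsilon_spec hex
  refine ⟨h1, (norm_eq_iInf_iff_real_inner_le_zero hc h1).1 ?_⟩
  have : Nonempty S := hne.to_subtype
  refine le_antisymm (le_ciInf fun w => h2 w w.2) (ciInf_le ⟨0, ?_⟩ (⟨_, h1⟩ : S))
  rintro _ ⟨w, rfl⟩
  exact norm_nonneg _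

lemma norm_proj_sub_proj_le (hS : IsClosed S) (hc : Convex ℝ S) (hne : S.Nonempty) (v w : Vec n) :
    ‖proj S v - proj S w‖ ≤ ‖v - w‖ := by
  obtain ⟨h1, h2⟩ := proj_spec hS hc hne v
  obtain ⟨h3, h4⟩ := proj_spec hS hc hne w
  have h5 := h2 _ h3
  have h6 := h4 _ h1
  have h7 : ‖proj S v - proj S w‖ ^ 2 ≤ inner ℝ (v - w) (proj S v - proj S w) := by
    rw [← real_inner_self_eq_norm_sq]
    rw [← neg_sub (proj S v) (proj S w), inner_neg_right] at h5
    have e : v - w = (v - proj S v) - (w - proj S w) + (proj S v - proj S w) := by abel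
    rw [e, inner_add_left, inner_sub_left (v - proj S v)]
    linarith
  have h8 := h7.trans (real_inner_le_norm _ _)
  by_contra h
  push Not at h
  nlinarith [norm_nonneg (v - w)]

lemma continuous_proj (hS : IsClosed S) (hc : Convex ℝ S) (hne : S.Nonempty) :
    Continuous (proj S) := by
  have : LipschitzWith 1 (proj S) := LipschitzWith.of_dist_le_mul fun v w => by
    simpa [dist_eq_norm] using norm_proj_sub_proj_le hS hc hne v w
  exact this.continuous

/-- A projected gradient step with a perturbed gradient, compared with a stationary point `u`. -/
lemma norm_proj_sub_le_of_isStationary (hS : IsClosed S) (hc : Convex ℝ S) {g' : Vec n → Vec n}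
    {u : Vec n} (hu : IsStationary g' S u) {τ : ℝ} (hτ : 0 ≤ τ) (v : Vec n) :
    ‖proj S v - u‖ ≤ ‖v - u + τ • g' u‖ := by
  obtain ⟨h1, h2⟩ := proj_spec hS hc ⟨u, hu.1⟩ v
  have h3 := h2 u hu.1
  have h4 := mul_nonneg hτ (hu.2 _ h1)
  have h5 : ‖proj S v - u‖ ^ 2 ≤ inner ℝ (v - u + τ • g' u) (proj S v - u) := by
    rw [← real_inner_self_eq_norm_sq]
    rw [← neg_sub (proj S v) u, inner_neg_right] at h3
    have e : v - u + τ • g' u = (v - proj S v) + (proj S v - u) + τ • g' u := by abel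
    rw [e, inner_add_left, inner_add_left, inner_smul_left, RCLike.conj_to_real]
    linarith
  have h6 := h5.trans (real_inner_le_norm _ _)
  by_contra h
  push Not at h
  nlinarith [norm_nonneg (v - u + τ • g' u)]

end Proj

/-! ### Descent of the potential in one iteration -/

/-- Young's inequality for the square of a sum. -/
lemma norm_add_sq_le_young {E : Type*} [NormedAddCommGroup E] [InnerProductSpace ℝ E] (a c : E)
    {s : ℝ} (hs : 0 < s) : ‖a + c‖ ^ 2 ≤ (1 + s) * ‖a‖ ^ 2 + (1 + 1 / s) * ‖c‖ ^ 2 := by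
  have h1 := norm_add_sq_real a c
  have h2 := real_inner_le_norm a c
  have h3 : 2 * (‖a‖ * ‖c‖) ≤ s * ‖a‖ ^ 2 + 1 / s * ‖c‖ ^ 2 := by
    have h4 : 0 ≤ (s * ‖a‖ - ‖c‖) ^ 2 / s := by positivity
    have h5 : (s * ‖a‖ - ‖c‖) ^ 2 / s = s * ‖a‖ ^ 2 + 1 / s * ‖c‖ ^ 2 - 2 * (‖a‖ * ‖c‖) := by
      field_simp; ring
    linarith
  nlinarith

/-- A lower bound in Young's form for the squared distance to a displaced point. -/
lemma young_sub_le {E : Type*} [NormedAddCommGroup E] [InnerProductSpace ℝ E] (x u v : E) {s : ℝ}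
    (hs0 : 0 < s) (hs1 : s ≤ 1) :
    (1 - s) * ‖x - u‖ ^ 2 - 1 / s * ‖u - v‖ ^ 2 ≤ ‖x - v‖ ^ 2 := by
  have e1 := norm_add_sq_le_young (x - v) (v - u) hs0
  rw [sub_add_sub_cancel, norm_sub_rev v] at e1
  have e2 := mul_le_mul_of_nonneg_left e1 (sub_nonneg.2 hs1)
  have e3 : (1 - s) * (1 + 1 / s) = 1 / s - s := by field_simp; ring
  have e4 : 0 ≤ s * ‖u - v‖ ^ 2 := by positivity
  have e5 : 0 ≤ s ^ 2 * ‖x - v‖ ^ 2 := by positivity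
  have e6 : (1 - s) * ((1 + s) * ‖x - v‖ ^ 2 + (1 + 1 / s) * ‖u - v‖ ^ 2) =
      ‖x - v‖ ^ 2 - s ^ 2 * ‖x - v‖ ^ 2 + ((1 - s) * (1 + 1 / s)) * ‖u - v‖ ^ 2 := by ring
  rw [e6, e3] at e2
  linarith

section Descent

variable {n m p : ℕ}

/-- The state after one iteration in which the oracle has answered `g`. -/
def Problem.next (Q : Problem n m p) (θ : Params) (s : State n m) (g : Vec n) : State n m :=
  { x := proj Q.X (s.x - θ.τ • (g + Q.A.adjoint (s.y + θ.η • (Q.A s.x - Q.b)) +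
      θ.ρ • Q.A.adjoint (Q.A s.x - Q.b) + θ.μ • (s.x - s.z)))
    y := s.y + θ.η • (Q.A s.x - Q.b)
    z := s.z + θ.β • (s.x - s.z) }

/-- The potential `‖x - x*(y, z)‖² - d(y, z) + 2 Ψ_μ(z)`, where `d(y, z) = K(x*(y, z), y, z)` is
the dual function of the proximal problem. -/
def Problem.potential (Q : Problem n m p) (ρ μ : ℝ) (s : State n m) : ℝ :=
  ‖s.x - Q.xStar ρ μ s.y s.z‖ ^ 2 - Q.proxLag ρ μ s.y s.z (Q.xStar ρ μ s.y s.z) +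
    2 * Q.envelope μ s.z

/-- The relations between the parameters and the constants of the problem on which the descent of
the potential rests. -/
structure Admissible (Q : Problem n m p) (θ : Params) (L σbar : ℝ) : Prop where
  smooth : IsSmoothFun L Q.f
  L_nonneg : 0 ≤ L
  rho_nonneg : 0 ≤ θ.ρ
  two_le_mu : 2 ≤ θ.μ
  four_mul_le_mu : 4 * L ≤ θ.μ
  tau_pos : 0 < θ.τ
  tau_le : θ.τ * (L + θ.ρ * ‖Q.A‖ ^ 2 + θ.μ) ^ 2 ≤ 1 / 6
  eta_pos : 0 < θ.η
  eta_le : θ.η * ‖Q.A‖ ^ 2 ≤ θ.τ / 200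
  beta_pos : 0 < θ.β
  beta_le : θ.β ≤ θ.τ / 100
  beta_le_eta : 36 * θ.μ * σbar ^ 2 * θ.β ≤ θ.η
  nonempty : Q.feasible.Nonempty
  errorBound : Q.IsErrorBound θ.ρ θ.μ σbar

namespace Admissible

variable {Q : Problem n m p} {θ : Params} {L σbar : ℝ}

lemma L_lt_mu (h : Admissible Q θ L σbar) : L < θ.μ := by
  linarith [h.four_mul_le_mu, h.two_le_mu, h.L_nonneg]

lemma mu_nonneg (h : Admissible Q θ L σbar) : 0 ≤ θ.μ := by linarith [h.two_le_mu]

/-- The dual function never exceeds the envelope, so the potential is bounded below. -/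
lemma le_potential (h : Admissible Q θ L σbar) {c : ℝ} (hc : ∀ x ∈ Q.feasible, c ≤ Q.f x)
    (s : State n m) : c ≤ Q.potential θ.ρ θ.μ s := by
  obtain ⟨h1, h2⟩ := Problem.xBar_spec h.smooth h.L_lt_mu h.nonempty s.z
  have h3 := (Problem.xStar_spec h.smooth h.rho_nonneg h.L_lt_mu h.nonempty s.y s.z).2 h1.1
  have h4 := hc _ h1
  have e := Problem.envelope_eq h.smooth h.L_lt_mu h.nonempty s.z
  have h5 : Q.proxLag θ.ρ θ.μ s.y s.z (Q.xBar θ.μ s.z) = Q.prox θ.μ s.z (Q.xBar θ.μ s.z) := by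
    simp [Problem.proxLag, Problem.augLag, Problem.prox, h1.2]
  simp only [Set.mem_ofPred_eq] at h3
  rw [h5] at h3
  have h6 : Q.f (Q.xBar θ.μ s.z) ≤ Q.prox θ.μ s.z (Q.xBar θ.μ s.z) :=
    le_add_of_nonneg_right (mul_nonneg (by linarith [h.two_le_mu]) (sq_nonneg _))
  unfold Problem.potential
  rw [e]
  linarith [sq_nonneg ‖s.x - Q.xStar θ.ρ θ.μ s.y s.z‖]

/-- One noisy projected gradient step contracts the distance to the minimizer `u` of
`K(·, y, z)`, up to noise. -/
lemma proj_step (h : Admissible Q θ L σbar) (x z : Vec n) (y : Vec m) (ζ : Vec n) :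
    ‖proj Q.X (x - θ.τ • (Q.lagGrad θ.ρ θ.μ y z x + ζ)) - Q.xStar θ.ρ θ.μ y z‖ ^ 2 ≤
      (1 - 2 * θ.τ * (θ.μ - L) + θ.τ / 6) * ‖x - Q.xStar θ.ρ θ.μ y z‖ ^ 2 -
      2 * θ.τ * inner ℝ (x - Q.xStar θ.ρ θ.μ y z - θ.τ •
        (Q.lagGrad θ.ρ θ.μ y z x - Q.lagGrad θ.ρ θ.μ y z (Q.xStar θ.ρ θ.μ y z))) ζ +
      θ.τ ^ 2 * ‖ζ‖ ^ 2 := by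
  set u := Q.xStar θ.ρ θ.μ y z with hu
  set lam := L + θ.ρ * ‖Q.A‖ ^ 2 + θ.μ with hlam
  set g' := Q.lagGrad θ.ρ θ.μ y z with hg'
  have hτ := h.tau_pos
  have h1 := norm_proj_sub_le_of_isStationary Q.isClosed_X Q.convex_X
    (Problem.xStar_isStationary h.smooth h.rho_nonneg h.L_lt_mu h.nonempty y z) hτ.le
    (x - θ.τ • (g' x + ζ))
  have e : x - θ.τ • (g' x + ζ) - u + θ.τ • g' u = (x - u - θ.τ • (g' x - g' u)) - θ.τ • ζ := by
    module
  rw [← hu, ← hg', e] at h1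
  have h2 := pow_le_pow_left₀ (norm_nonneg _) h1 2
  rw [norm_sub_sq_real _ (θ.τ • ζ), inner_smul_right, norm_smul, mul_pow, Real.norm_eq_abs,
    sq_abs, norm_sub_sq_real (x - u), inner_smul_right, norm_smul, mul_pow, Real.norm_eq_abs,
    sq_abs] at h2
  have h3 := (Problem.quadBounds_proxLag h.smooth h.rho_nonneg θ.μ y z).strongMono x u
  rw [← hg', real_inner_comm] at h3
  have h4 := Problem.norm_lagGrad_sub_le h.smooth h.rho_nonneg h.mu_nonneg y z x u
  rw [← hg', ← hlam] at h4
  have h5 := pow_le_pow_left₀ (norm_nonneg _) h4 2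
  rw [mul_pow] at h5
  have h6 : θ.τ ^ 2 * ‖g' x - g' u‖ ^ 2 ≤ θ.τ / 6 * ‖x - u‖ ^ 2 := by
    have h7 := mul_le_mul_of_nonneg_left h5 (sq_nonneg θ.τ)
    have h8 := mul_le_mul_of_nonneg_right h.tau_le (mul_nonneg hτ.le (sq_nonneg ‖x - u‖))
    rw [← hlam] at h8
    nlinarith
  have h9 := mul_le_mul_of_nonneg_left h3 hτ.le
  linarith

/-- Ascent of the dual function `d` in a dual step: `d(y', z) - d(y, z) ≥ ⟨A x*(y', z) - b, y' - y⟩`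
by concavity, and its change in a proximal step is `⟨μ (z - x*), z' - z⟩` to first order. -/
lemma dual_ascent (h : Admissible Q θ L σbar) (y y' : Vec m) (z z' : Vec n) :
    Q.proxLag θ.ρ θ.μ y z (Q.xStar θ.ρ θ.μ y z) +
      inner ℝ (Q.A (Q.xStar θ.ρ θ.μ y' z) - Q.b) (y' - y) +
      θ.μ * inner ℝ (z' - z) (z - Q.xStar θ.ρ θ.μ y' z) - 4 / 3 * θ.μ * ‖z' - z‖ ^ 2 ≤
    Q.proxLag θ.ρ θ.μ y' z' (Q.xStar θ.ρ θ.μ y' z') := by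
  set u := Q.xStar θ.ρ θ.μ y z
  set u1 := Q.xStar θ.ρ θ.μ y' z
  set u2 := Q.xStar θ.ρ θ.μ y' z'
  obtain ⟨m1, -⟩ := Problem.xStar_spec h.smooth h.rho_nonneg h.L_lt_mu h.nonempty y' z
  obtain ⟨m2, -⟩ := Problem.xStar_spec h.smooth h.rho_nonneg h.L_lt_mu h.nonempty y' z'
  have h1 : Q.proxLag θ.ρ θ.μ y z u ≤ Q.proxLag θ.ρ θ.μ y z u1 :=
    (Problem.xStar_spec h.smooth h.rho_nonneg h.L_lt_mu h.nonempty y z).2 m1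
  have h2 : Q.proxLag θ.ρ θ.μ y' z u1 ≤ Q.proxLag θ.ρ θ.μ y' z u2 :=
    (Problem.xStar_spec h.smooth h.rho_nonneg h.L_lt_mu h.nonempty y' z).2 m2
  have h3 : Q.proxLag θ.ρ θ.μ y' z u1 = Q.proxLag θ.ρ θ.μ y z u1 +
      inner ℝ (Q.A u1 - Q.b) (y' - y) := by
    simp only [Problem.proxLag, Problem.augLag, inner_sub_right]; ring
  have h4 : Q.proxLag θ.ρ θ.μ y' z' u2 - Q.proxLag θ.ρ θ.μ y' z u2 =
      θ.μ * inner ℝ (z' - z) (z - u2) + θ.μ / 2 * ‖z' - z‖ ^ 2 := by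
    rw [← prox_sub_prox Q]; simp only [Problem.proxLag, Problem.prox]; ring
  have h5 := Problem.norm_xStar_sub_le h.smooth h.rho_nonneg h.L_lt_mu h.mu_nonneg h.nonempty
    y' y' z' z
  rw [sub_self, norm_zero, mul_zero, zero_add] at h5
  have h6 : ‖u2 - u1‖ ≤ 4 / 3 * ‖z' - z‖ := by
    have hm : 3 / 4 * θ.μ ≤ θ.μ - L := by linarith [h.four_mul_le_mu]
    have h7 : 3 / 4 * θ.μ * ‖u2 - u1‖ ≤ θ.μ * ‖z' - z‖ :=
      (mul_le_mul_of_nonneg_right hm (norm_nonneg _)).trans h5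
    refine le_of_mul_le_mul_left ?_ (show 0 < θ.μ by linarith [h.two_le_mu])
    linarith
  have h8 := real_inner_le_norm (z' - z) (u2 - u1)
  have h9 : inner ℝ (z' - z) (z - u2) =
      inner ℝ (z' - z) (z - u1) - inner ℝ (z' - z) (u2 - u1) := by
    rw [← inner_sub_right]; congr 1; abel
  have h10 : inner ℝ (z' - z) (u2 - u1) ≤ 4 / 3 * ‖z' - z‖ ^ 2 := by
    have := mul_le_mul_of_nonneg_left h6 (norm_nonneg (z' - z))
    nlinarith
  have h11 := mul_le_mul_of_nonneg_left h10 h.mu_nonneg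
  have h12 : 0 ≤ θ.μ / 2 * ‖z' - z‖ ^ 2 :=
    mul_nonneg (by linarith [h.two_le_mu]) (sq_nonneg _)
  rw [h9] at h4
  linarith

lemma tau_bounds (h : Admissible Q θ L σbar) :
    θ.τ ≤ 1 / 24 ∧ θ.τ * (θ.μ - L) ≤ 1 / 12 := by
  have h2 := h.two_le_mu
  have h0 := h.L_nonneg
  have h3 : 0 ≤ θ.ρ * ‖Q.A‖ ^ 2 := mul_nonneg h.rho_nonneg (sq_nonneg _)
  have h1 := h.tau_le
  set lam := L + θ.ρ * ‖Q.A‖ ^ 2 + θ.μ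
  have h4 : 2 ≤ lam := by simp only [lam]; linarith
  have h5 : θ.μ - L ≤ lam := by simp only [lam]; linarith
  have hτ := h.tau_pos
  have h6 : 2 * lam ≤ lam ^ 2 := by nlinarith
  have h7 := mul_le_mul_of_nonneg_left h6 hτ.le
  have h8 := mul_le_mul_of_nonneg_left h4 hτ.le
  have h9 := mul_le_mul_of_nonneg_left h5 hτ.le
  constructor <;> linarith

lemma three_quarters_le (h : Admissible Q θ L σbar) : 3 / 4 * θ.μ ≤ θ.μ - L := by
  linarith [h.four_mul_le_mu]

lemma three_halves_le (h : Admissible Q θ L σbar) : 3 / 2 ≤ θ.μ - L := by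
  linarith [h.four_mul_le_mu, h.two_le_mu]

lemma eta_mul_residual_le (h : Admissible Q θ L σbar) (x u : Vec n) :
    θ.η * ‖Q.A x - Q.A u‖ ^ 2 ≤ θ.τ / 200 * ‖x - u‖ ^ 2 := by
  have e1 : ‖Q.A x - Q.A u‖ ^ 2 ≤ ‖Q.A‖ ^ 2 * ‖x - u‖ ^ 2 := by
    rw [← map_sub, ← mul_pow]
    exact pow_le_pow_left₀ (norm_nonneg _) (Q.A.le_opNorm _) 2
  have e2 := mul_le_mul_of_nonneg_left e1 h.eta_pos.le
  have e3 := mul_le_mul_of_nonneg_right h.eta_le (sq_nonneg ‖x - u‖)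
  linarith

/-- Displacement of the minimizer of the proximal augmented Lagrangian by the dual step. -/
lemma dual_drift (h : Admissible Q θ L σbar) (x z : Vec n) (y y' : Vec m)
    (hy : y' = y + θ.η • (Q.A x - Q.b)) {u₀ u₁ : Vec n}
    (h0 : u₀ = Q.xStar θ.ρ θ.μ y z) (h1 : u₁ = Q.xStar θ.ρ θ.μ y' z) {s : ℝ}
    (hs : s = θ.τ * (θ.μ - L) / 2) :
    1 / s * ‖u₁ - u₀‖ ^ 2 ≤
      θ.η / 150 * ‖Q.A u₁ - Q.b‖ ^ 2 + θ.τ / 30000 * ‖x - u₁‖ ^ 2 := by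
  have hτ := h.tau_pos
  have hη := h.eta_pos
  have hk2 := h.three_halves_le
  have e1 := Problem.norm_xStar_sub_le h.smooth h.rho_nonneg h.L_lt_mu h.mu_nonneg h.nonempty
    y' y z z
  rw [sub_self, norm_zero, mul_zero, add_zero, hy, add_sub_cancel_left, norm_smul,
    Real.norm_of_nonneg hη.le, ← hy, ← h0, ← h1] at e1
  set k := θ.μ - L
  set δ := ‖u₁ - u₀‖ ^ 2 with hδ
  set R := ‖Q.A x - Q.b‖ ^ 2 with hR
  have hs0 : 0 < s := by rw [hs]; positivity
  have hδ0 : 0 ≤ δ := sq_nonneg _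
  have hr : θ.η * R ≤
      2 * (θ.η * ‖Q.A u₁ - Q.b‖ ^ 2) + θ.τ / 100 * ‖x - u₁‖ ^ 2 := by
    have q1 := norm_add_sq_le_young (Q.A u₁ - Q.b) (Q.A x - Q.A u₁) one_pos
    rw [add_comm, sub_add_sub_cancel, ← hR] at q1
    have q2 := h.eta_mul_residual_le x u₁
    have q3 := mul_le_mul_of_nonneg_left q1 hη.le
    linarith
  have e2 : k ^ 2 * δ ≤ θ.τ / 200 * (θ.η * R) := by
    have q1 := pow_le_pow_left₀ (by positivity) e1 2
    have q2 := mul_le_mul_of_nonneg_right h.eta_le (show 0 ≤ θ.η * R by positivity)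
    calc k ^ 2 * δ = (k * ‖u₁ - u₀‖) ^ 2 := by rw [hδ]; ring
      _ ≤ (‖Q.A‖ * (θ.η * ‖Q.A x - Q.b‖)) ^ 2 := q1
      _ = θ.η * ‖Q.A‖ ^ 2 * (θ.η * R) := by rw [hR]; ring
      _ ≤ _ := q2
  have e3 : 9 / 4 * δ ≤ k ^ 2 * δ := by
    refine mul_le_mul_of_nonneg_right ?_ hδ0
    nlinarith
  rw [one_div_mul_eq_div, div_le_iff₀ hs0, hs]
  set B := θ.η / 150 * ‖Q.A u₁ - Q.b‖ ^ 2 + θ.τ / 30000 * ‖x - u₁‖ ^ 2 with hB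
  have e4 : θ.η * R ≤ 300 * B := by rw [hB]; linarith
  have e5 : 0 ≤ θ.τ * B := by positivity
  have e6 := mul_le_mul_of_nonneg_left e4 hτ.le
  have e7 := mul_le_mul_of_nonneg_left hk2 e5
  linarith

/-- Displacement of the minimizer of the proximal augmented Lagrangian by the proximal step. -/
lemma prox_drift (h : Admissible Q θ L σbar) (x z z' : Vec n) (y' : Vec m)
    (hz : z' = z + θ.β • (x - z)) {u₁ u₂ : Vec n} (h1 : u₁ = Q.xStar θ.ρ θ.μ y' z)
    (h2 : u₂ = Q.xStar θ.ρ θ.μ y' z') {s : ℝ} (hs : s = θ.τ * (θ.μ - L) / 2) :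
    (1 + 1 / s) * ‖u₁ - u₂‖ ^ 2 ≤ θ.μ * θ.β / 79 * ‖x - z‖ ^ 2 := by
  have hτ := h.tau_pos
  have hβ := h.beta_pos
  have hμ2 := h.two_le_mu
  have hk2 := h.three_halves_le
  have hs0 : 0 < s := by rw [hs]; positivity
  have e1 := Problem.norm_xStar_sub_le h.smooth h.rho_nonneg h.L_lt_mu h.mu_nonneg h.nonempty
    y' y' z z'
  rw [sub_self, norm_zero, mul_zero, zero_add, norm_sub_rev z, hz, add_sub_cancel_left, norm_smul,
    Real.norm_of_nonneg hβ.le, ← hz, ← h2, ← h1] at e1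
  have e2 : ‖u₁ - u₂‖ ≤ 4 / 3 * (θ.β * ‖x - z‖) := by
    have e3 : 3 / 4 * θ.μ * ‖u₁ - u₂‖ ≤ θ.μ * (θ.β * ‖x - z‖) :=
      (mul_le_mul_of_nonneg_right h.three_quarters_le (norm_nonneg _)).trans e1
    refine le_of_mul_le_mul_left ?_ (show 0 < θ.μ by linarith)
    linarith
  have e5 : (1 + 1 / s) * θ.β ≤ 1 / 72 := by
    have e6 : 1 / s * θ.β ≤ 1 / 75 := by
      rw [one_div_mul_eq_div, div_le_iff₀ hs0, hs]
      have := mul_le_mul_of_nonneg_left hk2 hτ.le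
      linarith [h.beta_le]
    linarith [h.beta_le, h.tau_bounds.1]
  calc (1 + 1 / s) * ‖u₁ - u₂‖ ^ 2 ≤ (1 + 1 / s) * (4 / 3 * (θ.β * ‖x - z‖)) ^ 2 := by gcongr
    _ = 16 / 9 * ((1 + 1 / s) * θ.β) * (θ.β * ‖x - z‖ ^ 2) := by ring
    _ ≤ 16 / 9 * (1 / 72) * (θ.β * ‖x - z‖ ^ 2) := by gcongr
    _ ≤ 2 / 79 * (θ.β * ‖x - z‖ ^ 2) := by gcongr; norm_num
    _ ≤ θ.μ / 79 * (θ.β * ‖x - z‖ ^ 2) := by gcongr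
    _ = _ := by ring

/-- First-order change of the dual and primal proximal values in the proximal step. The leading
term is `-μ β ‖x - z‖²`; in the application, `u₁` and `xb` are the minimizers of the proximal
augmented Lagrangian and of the constrained proximal problem. -/
lemma prox_descent (h : Admissible Q θ L σbar) (x z z' : Vec n)
    (hz : z' = z + θ.β • (x - z)) (u₁ xb : Vec n) :
    -(θ.μ * inner ℝ (z' - z) (z - u₁)) + 2 * (θ.μ * inner ℝ (z' - z) (z - xb)) ≤
      θ.μ * θ.β * (-(‖x - z‖ ^ 2 / 2) + ‖x - u₁‖ ^ 2 + 4 * ‖u₁ - xb‖ ^ 2) := by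
  have e1 : - inner ℝ (x - z) (z - u₁) + 2 * inner ℝ (x - z) (z - xb) =
      - ‖x - z‖ ^ 2 + inner ℝ (x - z) (x - u₁) + 2 * inner ℝ (x - z) (u₁ - xb) := by
    have q1 : z - u₁ = (x - u₁) - (x - z) := by abel
    have q2 : z - xb = (x - u₁) + (u₁ - xb) - (x - z) := by abel
    rw [q1, q2, inner_sub_right _ (x - u₁), inner_sub_right _ (x - u₁ + (u₁ - xb)),
      inner_add_right, real_inner_self_eq_norm_sq]
    ring
  have e2 : inner ℝ (x - z) (x - u₁) ≤ ‖x - z‖ ^ 2 / 4 + ‖x - u₁‖ ^ 2 := by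
    have q1 := real_inner_le_norm (x - z) (x - u₁)
    have q2 := sq_nonneg (‖x - z‖ / 2 - ‖x - u₁‖)
    linarith
  have e3 : 2 * inner ℝ (x - z) (u₁ - xb) ≤ ‖x - z‖ ^ 2 / 4 + 4 * ‖u₁ - xb‖ ^ 2 := by
    have q1 := real_inner_le_norm (x - z) (u₁ - xb)
    have q2 := sq_nonneg (‖x - z‖ / 2 - 2 * ‖u₁ - xb‖)
    linarith
  have e4 : - inner ℝ (x - z) (z - u₁) + 2 * inner ℝ (x - z) (z - xb) ≤
      -(‖x - z‖ ^ 2 / 2) + ‖x - u₁‖ ^ 2 + 4 * ‖u₁ - xb‖ ^ 2 := by linarith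
  have e5 := mul_le_mul_of_nonneg_left e4 (mul_nonneg h.mu_nonneg h.beta_pos.le)
  rw [hz, add_sub_cancel_left, inner_smul_left, inner_smul_left, RCLike.conj_to_real]
  linarith

/-- The part of the one-iteration change of the potential that does not involve the noise is at
most `-(μ β / 12) ‖z - x̄(z)‖²`. Here `u₀ = x*(y, z)`, `u₁ = x*(y⁺, z)` and `u₂ = x*(y⁺, z⁺)`. The
decrease consists of the contraction `‖x - u₁‖²` of the primal step, the dual ascent
`‖A u₁ - b‖²` and the descent `‖x - z‖²` of the proximal step; through the error bound, these three
dominate `‖z - x̄(z)‖²`. -/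
lemma deterministic_descent (h : Admissible Q θ L σbar) (x z : Vec n) (y y' : Vec m) (z' : Vec n)
    (hy : y' = y + θ.η • (Q.A x - Q.b)) (hz : z' = z + θ.β • (x - z)) {u₀ u₁ u₂ xb : Vec n}
    (h0 : u₀ = Q.xStar θ.ρ θ.μ y z) (h1 : u₁ = Q.xStar θ.ρ θ.μ y' z)
    (h2 : u₂ = Q.xStar θ.ρ θ.μ y' z') (hb : xb = Q.xBar θ.μ z) {s : ℝ}
    (hs : s = θ.τ * (θ.μ - L) / 2) :
    (1 + s) * ((1 - 2 * θ.τ * (θ.μ - L) + θ.τ / 6) * ‖x - u₁‖ ^ 2) +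
        (1 + 1 / s) * ‖u₁ - u₂‖ ^ 2 - ‖x - u₀‖ ^ 2 -
        inner ℝ (Q.A u₁ - Q.b) (y' - y) - θ.μ * inner ℝ (z' - z) (z - u₁) +
        4 / 3 * θ.μ * ‖z' - z‖ ^ 2 +
        2 * (θ.μ * inner ℝ (z' - z) (z - xb) + θ.μ / 2 * ‖z' - z‖ ^ 2) ≤
      -(θ.μ * θ.β / 12 * ‖z - xb‖ ^ 2) := by
  obtain ⟨hτ1, hτm⟩ := h.tau_bounds
  have hτ := h.tau_pos
  have hη := h.eta_pos
  have hβ := h.beta_pos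
  have hμ2 := h.two_le_mu
  have hk1 := h.three_quarters_le
  have hk2 := h.three_halves_le
  have hs0 : 0 < s := by rw [hs]; positivity
  have hs1 : s ≤ 1 / 24 := by rw [hs]; linarith
  have hu01 := h.dual_drift x z y y' hy h0 h1 hs
  have hu12 := h.prox_drift x z z' y' hz h1 h2 hs
  have hx0 := young_sub_le x u₁ u₀ hs0 (by linarith)
  have hprox := h.prox_descent x z z' hz u₁ xb
  have hdual : -inner ℝ (Q.A u₁ - Q.b) (y' - y) ≤
      -(θ.η / 2) * ‖Q.A u₁ - Q.b‖ ^ 2 + θ.τ / 400 * ‖x - u₁‖ ^ 2 := by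
    rw [hy, add_sub_cancel_left, inner_smul_right]
    have e1 := norm_sub_sq_real (Q.A x - Q.b) (Q.A u₁ - Q.b)
    rw [sub_sub_sub_cancel_right, real_inner_comm] at e1
    have e2 := h.eta_mul_residual_le x u₁
    have e3 := mul_nonneg hη.le (sq_nonneg ‖Q.A x - Q.b‖)
    rw [e1] at e2
    linarith
  have herr : ‖u₁ - xb‖ ^ 2 ≤ σbar ^ 2 * ‖Q.A u₁ - Q.b‖ ^ 2 := by
    obtain ⟨m1, m2⟩ := Problem.xStar_spec h.smooth h.rho_nonneg h.L_lt_mu h.nonempty y' z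
    obtain ⟨m3, m4⟩ := Problem.xBar_spec h.smooth h.L_lt_mu h.nonempty z
    have := h.errorBound y' z _ _ m1 m2 m3 m4
    rw [← h1, ← hb] at this
    have := pow_le_pow_left₀ (norm_nonneg _) this 2
    rwa [mul_pow] at this
  have hz2 : ‖z' - z‖ ^ 2 = θ.β ^ 2 * ‖x - z‖ ^ 2 := by
    rw [hz, add_sub_cancel_left, norm_smul, mul_pow, Real.norm_of_nonneg hβ.le]
  -- the error bound turns the three gains into stationarity
  have hstat : ‖z - xb‖ ^ 2 ≤ 3 * (‖x - z‖ ^ 2 + ‖x - u₁‖ ^ 2 + ‖u₁ - xb‖ ^ 2) := by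
    have q1 : ‖z - xb‖ ≤ ‖x - z‖ + ‖x - u₁‖ + ‖u₁ - xb‖ := by
      have : z - xb = -(x - z) + (x - u₁) + (u₁ - xb) := by abel
      rw [this]
      refine norm_add₃_le.trans ?_
      rw [norm_neg]
    have q2 := pow_le_pow_left₀ (norm_nonneg _) q1 2
    have q3 := sq_nonneg (‖x - z‖ - ‖x - u₁‖)
    have q4 := sq_nonneg (‖x - z‖ - ‖u₁ - xb‖)
    have q5 := sq_nonneg (‖x - u₁‖ - ‖u₁ - xb‖)
    linarith
  have hμβ : 0 < θ.μ * θ.β := by positivity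
  rw [hz2]
  set k := θ.μ - L
  have hν0 : 0 ≤ ‖Q.A u₁ - Q.b‖ ^ 2 := sq_nonneg _
  generalize ‖Q.A u₁ - Q.b‖ ^ 2 = ν at *
  generalize inner ℝ (z' - z) (z - u₁) = i₁ at *
  generalize inner ℝ (z' - z) (z - xb) = i₂ at *
  generalize inner ℝ (Q.A u₁ - Q.b) (y' - y) = i₃ at *
  have hD0 : 0 ≤ ‖x - u₁‖ ^ 2 := sq_nonneg _
  have he0 : 0 ≤ ‖x - z‖ ^ 2 := sq_nonneg _
  generalize ‖x - u₁‖ ^ 2 = D at *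
  generalize ‖x - z‖ ^ 2 = e at *
  generalize ‖u₁ - xb‖ ^ 2 = G at *
  have hcontr : (1 + s) * ((1 - 2 * θ.τ * k + θ.τ / 6) * D) - (1 - s) * D ≤
      -(7 / 8 * (θ.τ * k)) * D := by
    have e1 : (1 + s) * (1 - 2 * θ.τ * k + θ.τ / 6) - (1 - s) ≤ -(7 / 8 * (θ.τ * k)) := by
      have e2 : θ.τ * k = 2 * s := by rw [hs]; ring
      have e3 : 1 - 2 * θ.τ * k + θ.τ / 6 = 1 - 4 * s + θ.τ / 6 := by rw [mul_assoc, e2]; ring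
      rw [e3, e2]
      have e4 := mul_le_mul_of_nonneg_left hk2 hτ.le
      have e5 := mul_le_mul_of_nonneg_right hs1 hτ.le
      have e6 := sq_nonneg s
      linarith
    have := mul_le_mul_of_nonneg_right e1 hD0
    linarith
  have hβη : θ.μ * θ.β * G ≤ θ.η / 36 * ν := by
    have q1 := mul_le_mul_of_nonneg_right h.beta_le_eta hν0
    have q2 := mul_le_mul_of_nonneg_left herr hμβ.le
    linarith
  have hsec : θ.μ * (θ.β ^ 2 * e) ≤ θ.μ * θ.β * e / 2400 := by
    have hβ1 : θ.β ≤ 1 / 2400 := by linarith [h.beta_le]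
    have := mul_le_mul_of_nonneg_right hβ1 (mul_nonneg hμβ.le he0)
    linarith
  have hfin := mul_le_mul_of_nonneg_left hstat (show 0 ≤ θ.μ * θ.β / 12 by positivity)
  have hβD : θ.μ * θ.β * D ≤ θ.τ * k / 75 * D := by
    refine mul_le_mul_of_nonneg_right ?_ hD0
    have q1 := mul_le_mul_of_nonneg_left h.beta_le h.mu_nonneg
    have q2 := mul_le_mul_of_nonneg_left hk1 hτ.le
    linarith
  have hτD : 3 / 2 * (θ.τ * D) ≤ θ.τ * k * D := by
    have := mul_le_mul_of_nonneg_right hk2 (mul_nonneg hτ.le hD0)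
    linarith
  have hτD0 : 0 ≤ θ.τ * D := by positivity
  have hην : 0 ≤ θ.η * ν := by positivity
  have hμβe : 0 ≤ θ.μ * θ.β * e := by positivity
  linarith

/-- Descent of the potential in one iteration: up to a term linear in the noise `g - ∇f(x)`, which
vanishes in expectation, and a term of order `τ²`, the potential drops by a multiple of
`‖z - x̄(z)‖²`. -/
lemma descent (h : Admissible Q θ L σbar) (s : State n m) :
    ∃ (U : ℝ) (w : Vec n),
      U ≤ Q.potential θ.ρ θ.μ s - θ.μ * θ.β / 12 * ‖s.z - Q.xBar θ.μ s.z‖ ^ 2 ∧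
      ∀ g, Q.potential θ.ρ θ.μ (Q.next θ s g) ≤
        U + inner ℝ w (g - gradient Q.f s.x) + 2 * θ.τ ^ 2 * ‖g - gradient Q.f s.x‖ ^ 2 := by
  obtain ⟨x, y, z⟩ := s
  set y' := y + θ.η • (Q.A x - Q.b) with hy
  set z' := z + θ.β • (x - z) with hz
  set u₀ := Q.xStar θ.ρ θ.μ y z with h0
  set u₁ := Q.xStar θ.ρ θ.μ y' z with h1
  set u₂ := Q.xStar θ.ρ θ.μ y' z' with h2
  set xb := Q.xBar θ.μ z with hb
  set s := θ.τ * (θ.μ - L) / 2 with hs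
  have hs0 : 0 < s := by
    have := sub_pos.2 h.L_lt_mu
    have := h.tau_pos
    positivity
  have hs1 : s ≤ 1 := by linarith [h.tau_bounds.2]
  have hdet := h.deterministic_descent x z y y' z' hy hz h0 h1 h2 hb hs
  have hdual := h.dual_ascent y y' z z'
  have henv := Problem.envelope_sub_le h.smooth h.L_lt_mu h.nonempty z z'
  rw [← h0, ← h1, ← h2] at hdual
  rw [← hb] at henv
  set v := x - u₁ - θ.τ • (Q.lagGrad θ.ρ θ.μ y' z x - Q.lagGrad θ.ρ θ.μ y' z u₁) with hv
  refine ⟨(1 + s) * ((1 - 2 * θ.τ * (θ.μ - L) + θ.τ / 6) * ‖x - u₁‖ ^ 2) +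
    (1 + 1 / s) * ‖u₁ - u₂‖ ^ 2 - Q.proxLag θ.ρ θ.μ y' z' u₂ + 2 * Q.envelope θ.μ z',
    -((1 + s) * (2 * θ.τ)) • v, ?_, fun g => ?_⟩
  · simp only [Problem.potential, ← h0]
    linarith
  · set ζ := g - gradient Q.f x with hζ
    have hG : g + Q.A.adjoint y' + θ.ρ • Q.A.adjoint (Q.A x - Q.b) + θ.μ • (x - z) =
        Q.lagGrad θ.ρ θ.μ y' z x + ζ := by
      simp only [Problem.lagGrad, hζ]; abel
    have hstep := h.proj_step x z y' ζ
    rw [← h1, ← hv, ← hG] at hstep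
    simp only [Problem.potential, Problem.next, ← hy, ← hz, ← h2]
    set x' := proj Q.X
      (x - θ.τ • (g + Q.A.adjoint y' + θ.ρ • Q.A.adjoint (Q.A x - Q.b) + θ.μ • (x - z)))
    have hyoung := norm_add_sq_le_young (x' - u₁) (u₁ - u₂) hs0
    rw [sub_add_sub_cancel] at hyoung
    have e1 := mul_le_mul_of_nonneg_left hstep (show 0 ≤ 1 + s by linarith)
    have e2 : (1 + s) * (θ.τ ^ 2 * ‖ζ‖ ^ 2) ≤ 2 * θ.τ ^ 2 * ‖ζ‖ ^ 2 := by
      have : 0 ≤ θ.τ ^ 2 * ‖ζ‖ ^ 2 := by positivity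
      nlinarith
    rw [inner_smul_left, RCLike.conj_to_real]
    linarith

end Admissible

end Descent

/-! ### Execution of the algorithm -/

section Execution

variable {n m p : ℕ} {Ξ : Type*}

lemma OracleProg.exec_bind {α β : Type} (F : Vec n → Ξ → Vec n) (ξ : ℕ → Ξ)
    (P : OracleProg n α) (k : α → OracleProg n β) (j : ℕ) :
    (P.bind k).exec F ξ j = (k (P.exec F ξ j).1).exec F ξ (P.exec F ξ j).2 := by
  induction P generalizing j with
  | ret a => rfl
  | query x c ih => exact ih _ _

/-- The state after `t` iterations with the sample stream `ζ`. -/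
def Problem.stateAt (Q : Problem n m p) (θ : Params) (x₀ : Vec n) (y₀ : Vec m)
    (F : Vec n → Ξ → Vec n) (ζ : ℕ → Ξ) : ℕ → State n m
  | 0 => { x := x₀, y := y₀, z := x₀ }
  | t + 1 => Q.next θ (Q.stateAt θ x₀ y₀ F ζ t) (F (Q.stateAt θ x₀ y₀ F ζ t).x (ζ t))

lemma Problem.exec_alm (Q : Problem n m p) (θ : Params) (x₀ : Vec n) (y₀ : Vec m)
    (F : Vec n → Ξ → Vec n) (ζ : ℕ → Ξ) (t : ℕ) :
    (Q.alm θ x₀ y₀ t).exec F ζ 0 = (Q.stateAt θ x₀ y₀ F ζ t, t) := by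
  induction t with
  | zero => rfl
  | succ t ih =>
    rw [Problem.alm, OracleProg.exec_bind, ih]
    rfl

lemma Problem.oracleCalls_eq (Q : Problem n m p) (θ : Params) (x₀ : Vec n) (y₀ : Vec m)
    (F : Vec n → Ξ → Vec n) (ζ : ℕ → Ξ) (t : ℕ) : Q.oracleCalls θ x₀ y₀ F ζ t = t := by
  rw [Problem.oracleCalls, Problem.exec_alm]

lemma Problem.zIter_eq (Q : Problem n m p) (θ : Params) (x₀ : Vec n) (y₀ : Vec m)
    (F : Vec n → Ξ → Vec n) (ζ : ℕ → Ξ) (t : ℕ) :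
    Q.zIter θ x₀ y₀ F ζ t = (Q.stateAt θ x₀ y₀ F ζ t).z := by
  rw [Problem.zIter, Problem.exec_alm]

end Execution

/-! ### Measurability and independence of the iterates -/

section Measurability

variable {n m p : ℕ} {Ξ : Type*} [MeasurableSpace Ξ] {Q : Problem n m p} {θ : Params}
  {L σbar : ℝ}

/-- The σ-algebra that makes the three components measurable. -/
instance : MeasurableSpace (State n m) :=
  MeasurableSpace.comap (fun s : State n m => (s.x, s.y, s.z)) inferInstance

lemma measurable_state_iff {Ω : Type*} [MeasurableSpace Ω] {s : Ω → State n m} :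
    Measurable s ↔ Measurable (fun ω => (s ω).x) ∧ Measurable (fun ω => (s ω).y) ∧
      Measurable fun ω => (s ω).z := by
  rw [measurable_comap_iff]
  constructor
  · intro h
    exact ⟨measurable_fst.comp h, (measurable_fst.comp measurable_snd).comp h,
      (measurable_snd.comp measurable_snd).comp h⟩
  · rintro ⟨h1, h2, h3⟩
    exact h1.prodMk (h2.prodMk h3)

lemma Admissible.measurable_next (h : Admissible Q θ L σbar) {Ω : Type*} [MeasurableSpace Ω]
    {s : Ω → State n m} {g : Ω → Vec n} (hs : Measurable s) (hg : Measurable g) :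
    Measurable fun ω => Q.next θ (s ω) (g ω) := by
  obtain ⟨hx, hy, hz⟩ := measurable_state_iff.1 hs
  have hA : Measurable Q.A := Q.A.continuous.measurable
  have hA' : Measurable Q.A.adjoint := Q.A.adjoint.continuous.measurable
  have hy' : Measurable fun ω => (s ω).y + θ.η • (Q.A (s ω).x - Q.b) := by fun_prop
  have hproj : Measurable (proj Q.X) :=
    (continuous_proj Q.isClosed_X Q.convex_X ⟨_, h.nonempty.some_mem.1⟩).measurable
  refine measurable_state_iff.2 ⟨hproj.comp ?_, hy', by unfold Problem.next; fun_prop⟩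
  fun_prop

lemma Admissible.measurable_potential (h : Admissible Q θ L σbar) :
    Measurable (Q.potential θ.ρ θ.μ) := by
  obtain ⟨hx, hy, hz⟩ : Measurable (fun s : State n m => s.x) ∧
      Measurable (fun s : State n m => s.y) ∧ Measurable fun s : State n m => s.z :=
    measurable_state_iff.1 measurable_id
  have hc : Measurable fun q : Vec m × Vec n => Q.xStar θ.ρ θ.μ q.1 q.2 :=
    (Problem.continuous_xStar h.smooth h.rho_nonneg h.L_lt_mu h.mu_nonneg h.nonempty).measurable
  have hf : Measurable Q.f := h.smooth.1.continuous.measurable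
  have he : Measurable (Q.envelope θ.μ) := (Problem.differentiable_envelope h.smooth h.L_lt_mu
    h.mu_nonneg h.nonempty).continuous.measurable
  have hA : Measurable Q.A := Q.A.continuous.measurable
  unfold Problem.potential Problem.proxLag Problem.augLag
  -- only the joint measurability of `x*` matters from here on
  generalize Q.xStar θ.ρ θ.μ = u at hc
  have hu : Measurable fun s : State n m => u s.y s.z := hc.comp (hy.prodMk hz)
  have h1 : Measurable fun s : State n m => ‖s.x - u s.y s.z‖ ^ 2 := by fun_prop
  have h2 : Measurable fun s : State n m => inner ℝ (Q.A (u s.y s.z) - Q.b) s.y := by fun_prop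
  have h3 : Measurable fun s : State n m => ‖Q.A (u s.y s.z) - Q.b‖ ^ 2 := by fun_prop
  have h4 : Measurable fun s : State n m => ‖u s.y s.z - s.z‖ ^ 2 := by fun_prop
  have h5 : Measurable fun s : State n m => Q.f (u s.y s.z) := by fun_prop
  have h6 : Measurable fun s : State n m => Q.envelope θ.μ s.z := by fun_prop
  exact (h1.sub (((h5.add h2).add (h3.const_mul _)).add (h4.const_mul _))).add (h6.const_mul 2)

/-- After `t` iterations the state is measurable with respect to the first `t` samples. -/
lemma Admissible.measurable_stateAt (h : Admissible Q θ L σbar) (x₀ : Vec n) (y₀ : Vec m)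
    {F : Vec n → Ξ → Vec n} (hF : Measurable (Function.uncurry F)) {Ω : Type*}
    [MeasurableSpace Ω] {ζ : ℕ → Ω → Ξ} (t : ℕ) (hζ : ∀ i < t, Measurable (ζ i)) :
    Measurable fun ω => Q.stateAt θ x₀ y₀ F (fun i => ζ i ω) t := by
  induction t with
  | zero => exact measurable_const
  | succ t ih =>
    have hs := ih fun i hi => hζ i (hi.trans (Nat.lt_succ_self t))
    exact h.measurable_next hs
      (hF.comp ((measurable_state_iff.1 hs).1.prodMk (hζ t (Nat.lt_succ_self t))))

lemma Admissible.indepFun_stateAt (h : Admissible Q θ L σbar) (x₀ : Vec n) (y₀ : Vec m)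
    {F : Vec n → Ξ → Vec n} (hF : Measurable (Function.uncurry F)) {Ω : Type*}
    [MeasurableSpace Ω] {P : Measure Ω} {ξ : ℕ → Ω → Ξ} (hξ : ∀ t, Measurable (ξ t))
    (hind : iIndepFun ξ P) (t : ℕ) :
    IndepFun (fun ω => Q.stateAt θ x₀ y₀ F (fun i => ξ i ω) t) (ξ t) P := by
  have h1 := indep_iSup_of_disjoint (m := fun i => MeasurableSpace.comap (ξ i) inferInstance)
    (fun i => (hξ i).comap_le) hind
    (show Disjoint (Set.Iio t) {t} by simp)
  rw [IndepFun_iff_Indep]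
  refine indep_of_indep_of_le_left (indep_of_indep_of_le_right h1 ?_) ?_
  · exact le_iSup₂_of_le t rfl le_rfl
  · refine Measurable.comap_le ?_
    refine @Admissible.measurable_stateAt n m p Ξ _ Q θ L σbar h x₀ y₀ F hF Ω
      (⨆ i ∈ Set.Iio t, MeasurableSpace.comap (ξ i) inferInstance) ξ t fun i hi => ?_
    exact Measurable.mono (comap_measurable (ξ i))
      (le_iSup₂_of_le (f := fun i (_ : i ∈ Set.Iio t) =>
        MeasurableSpace.comap (ξ i) inferInstance) i hi le_rfl) le_rfl

end Measurability

/-! ### Descent in expectation -/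

section Expectation

variable {n m p : ℕ} {Ξ : Type*} [MeasurableSpace Ξ] {Q : Problem n m p} {θ : Params}
  {L σbar : ℝ}

/-- One iteration from a fixed state, in expectation over a fresh sample. -/
lemma Admissible.lintegral_next_le (h : Admissible Q θ L σbar) {fLow : ℝ}
    (hlow : ∀ x ∈ Q.feasible, fLow ≤ Q.f x) {F : Vec n → Ξ → Vec n} {D : Measure Ξ}
    [IsProbabilityMeasure D] {σ : ℝ} (hF : IsStochGrad Q.f F D σ) (s : State n m) :
    ∫⁻ a, ENNReal.ofReal (Q.potential θ.ρ θ.μ (Q.next θ s (F s.x a)) - fLow) ∂D +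
        ENNReal.ofReal (θ.μ * θ.β / 12 * ‖s.z - Q.xBar θ.μ s.z‖ ^ 2) ≤
      ENNReal.ofReal (Q.potential θ.ρ θ.μ s - fLow) + ENNReal.ofReal (2 * θ.τ ^ 2 * σ ^ 2) := by
  obtain ⟨U, w, hU, hw⟩ := h.descent s
  set v : Ξ → Vec n := fun a => F s.x a - gradient Q.f s.x with hv
  have hvint : Integrable v D := (hF.integrable s.x).sub (integrable_const _)
  have hv0 : ∫ a, v a ∂D = 0 := by
    rw [hv, integral_sub (hF.integrable s.x) (integrable_const _), hF.unbiased]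
    simp
  have hi1 : Integrable (fun a => inner ℝ w (v a)) D := hvint.const_inner w
  have hi2 : Integrable (fun a => 2 * θ.τ ^ 2 * ‖v a‖ ^ 2) D := (hF.integrable_sq s.x).const_mul _
  have hi0 : Integrable (fun a => (U - fLow) + inner ℝ w (v a)) D := (integrable_const _).add hi1
  have hi : Integrable (fun a => (U - fLow) + inner ℝ w (v a) + 2 * θ.τ ^ 2 * ‖v a‖ ^ 2) D :=
    hi0.add hi2
  have hle : ∀ a, Q.potential θ.ρ θ.μ (Q.next θ s (F s.x a)) - fLow ≤
      (U - fLow) + inner ℝ w (v a) + 2 * θ.τ ^ 2 * ‖v a‖ ^ 2 := fun a => by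
    have := hw (F s.x a)
    simp only [hv]
    linarith
  have hnn : ∀ a, 0 ≤ (U - fLow) + inner ℝ w (v a) + 2 * θ.τ ^ 2 * ‖v a‖ ^ 2 := fun a =>
    (sub_nonneg.2 (h.le_potential hlow _)).trans (hle a)
  have hint : ∫ a, ((U - fLow) + inner ℝ w (v a) + 2 * θ.τ ^ 2 * ‖v a‖ ^ 2) ∂D ≤
      U - fLow + 2 * θ.τ ^ 2 * σ ^ 2 := by
    rw [integral_add hi0 hi2, integral_add (integrable_const _) hi1,
      integral_inner hvint, hv0, inner_zero_right, integral_const_mul, integral_const]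
    have := mul_le_mul_of_nonneg_left (hF.variance_le s.x)
      (show 0 ≤ 2 * θ.τ ^ 2 by positivity)
    simp only [probReal_univ, one_smul, add_zero]
    linarith
  have hβ : 0 ≤ θ.μ * θ.β / 12 * ‖s.z - Q.xBar θ.μ s.z‖ ^ 2 :=
    mul_nonneg (div_nonneg (mul_nonneg h.mu_nonneg h.beta_pos.le) (by norm_num)) (sq_nonneg _)
  have h1 : ∫⁻ a, ENNReal.ofReal (Q.potential θ.ρ θ.μ (Q.next θ s (F s.x a)) - fLow) ∂D ≤
      ENNReal.ofReal (∫ a, ((U - fLow) + inner ℝ w (v a) + 2 * θ.τ ^ 2 * ‖v a‖ ^ 2) ∂D) := by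
    rw [ofReal_integral_eq_lintegral_ofReal hi (Filter.Eventually.of_forall hnn)]
    exact lintegral_mono fun a => ENNReal.ofReal_le_ofReal (hle a)
  refine (add_le_add_left h1 _).trans ?_
  rw [← ENNReal.ofReal_add (integral_nonneg hnn) hβ, ← ENNReal.ofReal_add
    (sub_nonneg.2 (h.le_potential hlow _)) (by positivity)]
  exact ENNReal.ofReal_le_ofReal (by linarith)

/-- One iteration of the algorithm, in expectation. -/
lemma Admissible.lintegral_stateAt_succ_le (h : Admissible Q θ L σbar) {fLow : ℝ}
    (hlow : ∀ x ∈ Q.feasible, fLow ≤ Q.f x) {F : Vec n → Ξ → Vec n} {D : Measure Ξ}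
    {σ : ℝ} (hF : IsStochGrad Q.f F D σ) (x₀ : Vec n) (y₀ : Vec m) {Ω : Type*}
    [MeasurableSpace Ω] {P : Measure Ω} [IsProbabilityMeasure P] {ξ : ℕ → Ω → Ξ}
    (hξ : ∀ t, Measurable (ξ t)) (hlaw : ∀ t, P.map (ξ t) = D) (hind : iIndepFun ξ P) (t : ℕ) :
    ∫⁻ ω, ENNReal.ofReal (Q.potential θ.ρ θ.μ
          (Q.stateAt θ x₀ y₀ F (fun i => ξ i ω) (t + 1)) - fLow) ∂P +
        ∫⁻ ω, ENNReal.ofReal (θ.μ * θ.β / 12 * ‖(Q.stateAt θ x₀ y₀ F (fun i => ξ i ω) t).z -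
          Q.xBar θ.μ (Q.stateAt θ x₀ y₀ F (fun i => ξ i ω) t).z‖ ^ 2) ∂P ≤
      ∫⁻ ω, ENNReal.ofReal (Q.potential θ.ρ θ.μ
          (Q.stateAt θ x₀ y₀ F (fun i => ξ i ω) t) - fLow) ∂P +
        ENNReal.ofReal (2 * θ.τ ^ 2 * σ ^ 2) := by
  have : IsProbabilityMeasure D := by
    rw [← hlaw 0]; exact Measure.isProbabilityMeasure_map (hξ 0).aemeasurable
  set S : Ω → State n m := fun ω => Q.stateAt θ x₀ y₀ F (fun i => ξ i ω) t with hS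
  have hSm : Measurable S := h.measurable_stateAt x₀ y₀ hF.measurable t fun i _ => hξ i
  have hprob : IsProbabilityMeasure (P.map S) := Measure.isProbabilityMeasure_map hSm.aemeasurable
  have hprod : P.map (fun ω => (S ω, ξ t ω)) = (P.map S).prod D := by
    rw [(indepFun_iff_map_prod_eq_prod_map_map hSm.aemeasurable (hξ t).aemeasurable).1
      (h.indepFun_stateAt x₀ y₀ hF.measurable hξ hind t), hlaw]
  have hxm : Measurable fun s : State n m => s.x := (measurable_state_iff.1 measurable_id).1
  have hzm : Measurable fun s : State n m => s.z := (measurable_state_iff.1 measurable_id).2.2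
  have hnext : Measurable fun q : State n m × Ξ => Q.next θ q.1 (F q.1.x q.2) :=
    h.measurable_next measurable_fst
      (hF.measurable.comp ((hxm.comp measurable_fst).prodMk measurable_snd))
  have hφ : Measurable fun q : State n m × Ξ =>
      ENNReal.ofReal (Q.potential θ.ρ θ.μ (Q.next θ q.1 (F q.1.x q.2)) - fLow) :=
    ((h.measurable_potential.comp hnext).sub_const _).ennreal_ofReal
  have hψ : Measurable fun s : State n m =>
      ENNReal.ofReal (θ.μ * θ.β / 12 * ‖s.z - Q.xBar θ.μ s.z‖ ^ 2) :=
    (((hzm.sub ((Problem.continuous_xBar h.smooth h.L_lt_mu h.mu_nonneg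
      h.nonempty).measurable.comp hzm)).norm.pow_const 2).const_mul _).ennreal_ofReal
  have hV : Measurable fun s : State n m =>
      ENNReal.ofReal (Q.potential θ.ρ θ.μ s - fLow) :=
    (h.measurable_potential.sub_const _).ennreal_ofReal
  have e1 : ∫⁻ ω, ENNReal.ofReal (Q.potential θ.ρ θ.μ
      (Q.stateAt θ x₀ y₀ F (fun i => ξ i ω) (t + 1)) - fLow) ∂P =
      ∫⁻ s, ∫⁻ a, ENNReal.ofReal (Q.potential θ.ρ θ.μ (Q.next θ s (F s.x a)) - fLow) ∂D
        ∂(P.map S) := by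
    rw [← lintegral_prod _ hφ.aemeasurable, ← hprod, lintegral_map hφ (hSm.prodMk (hξ t))]
    rfl
  rw [e1, ← lintegral_map (f := fun s : State n m =>
      ENNReal.ofReal (θ.μ * θ.β / 12 * ‖s.z - Q.xBar θ.μ s.z‖ ^ 2)) hψ hSm,
    ← lintegral_map (f := fun s : State n m =>
      ENNReal.ofReal (Q.potential θ.ρ θ.μ s - fLow)) hV hSm, ← lintegral_add_right _ hψ]
  refine (lintegral_mono fun s => h.lintegral_next_le hlow hF s).trans_eq ?_
  rw [lintegral_add_right _ measurable_const, lintegral_const, measure_univ, mul_one]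

/-- The descent inequalities of `N` iterations, added up. -/
lemma Admissible.sum_lintegral_le (h : Admissible Q θ L σbar) {fLow : ℝ}
    (hlow : ∀ x ∈ Q.feasible, fLow ≤ Q.f x) {F : Vec n → Ξ → Vec n} {D : Measure Ξ}
    {σ : ℝ} (hF : IsStochGrad Q.f F D σ) (x₀ : Vec n) (y₀ : Vec m) {Ω : Type*}
    [MeasurableSpace Ω] {P : Measure Ω} [IsProbabilityMeasure P] {ξ : ℕ → Ω → Ξ}
    (hξ : ∀ t, Measurable (ξ t)) (hlaw : ∀ t, P.map (ξ t) = D) (hind : iIndepFun ξ P) (N : ℕ) :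
    ∑ t ∈ Finset.range N, ∫⁻ ω, ENNReal.ofReal (θ.μ * θ.β / 12 *
        ‖(Q.stateAt θ x₀ y₀ F (fun i => ξ i ω) t).z -
          Q.xBar θ.μ (Q.stateAt θ x₀ y₀ F (fun i => ξ i ω) t).z‖ ^ 2) ∂P ≤
      ENNReal.ofReal (Q.potential θ.ρ θ.μ ⟨x₀, y₀, x₀⟩ - fLow +
        N * (2 * θ.τ ^ 2 * σ ^ 2)) := by
  have key : ∫⁻ ω, ENNReal.ofReal (Q.potential θ.ρ θ.μ
        (Q.stateAt θ x₀ y₀ F (fun i => ξ i ω) N) - fLow) ∂P +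
      ∑ t ∈ Finset.range N, ∫⁻ ω, ENNReal.ofReal (θ.μ * θ.β / 12 *
        ‖(Q.stateAt θ x₀ y₀ F (fun i => ξ i ω) t).z -
          Q.xBar θ.μ (Q.stateAt θ x₀ y₀ F (fun i => ξ i ω) t).z‖ ^ 2) ∂P ≤
      ENNReal.ofReal (Q.potential θ.ρ θ.μ ⟨x₀, y₀, x₀⟩ - fLow) +
        N * ENNReal.ofReal (2 * θ.τ ^ 2 * σ ^ 2) := by
    induction N with
    | zero => simp [Problem.stateAt]
    | succ N ih =>
      have h1 := h.lintegral_stateAt_succ_le hlow hF x₀ y₀ hξ hlaw hind N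
      rw [Finset.sum_range_succ, add_comm (Finset.sum _ _), ← add_assoc]
      refine (add_le_add_left h1 _).trans ?_
      rw [add_right_comm]
      refine (add_le_add_left ih _).trans_eq ?_
      push_cast
      rw [add_mul, one_mul, add_assoc]
  refine (le_add_self.trans key).trans_eq ?_
  rw [ENNReal.ofReal_add (sub_nonneg.2 (h.le_potential hlow _)) (by positivity),
    ENNReal.ofReal_mul (Nat.cast_nonneg N), ENNReal.ofReal_natCast]

end Expectation

/-! ### Random output index -/

section RandomIndex

variable {Ω 𝒳 : Type*} [MeasurableSpace Ω] [MeasurableSpace 𝒳] {P : Measure Ω}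
  [IsProbabilityMeasure P]

/-- An independent uniform index turns the expectation into an average over the indices. -/
lemma lintegral_uniform_index {T : ℕ} {tStar : Ω → ℕ} (ht : Measurable tStar)
    (hlaw : P.map tStar = uniformOn (Set.Icc 1 T)) {X : Ω → 𝒳} (hX : Measurable X)
    (hind : IndepFun tStar X P) {Φ : ℕ → 𝒳 → ENNReal} (hΦ : ∀ t, Measurable (Φ t)) :
    ∫⁻ ω, Φ (tStar ω) (X ω) ∂P =
      (T : ENNReal)⁻¹ * ∑ t ∈ Finset.Icc 1 T, ∫⁻ ω, Φ t (X ω) ∂P := by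
  have hm : Measurable fun q : ℕ × 𝒳 => Φ q.1 q.2 :=
    measurable_from_prod_countable_right fun t => hΦ t
  have hprob : IsProbabilityMeasure (P.map X) := Measure.isProbabilityMeasure_map hX.aemeasurable
  have hprob' : IsProbabilityMeasure (P.map tStar) :=
    Measure.isProbabilityMeasure_map ht.aemeasurable
  have e1 : ∫⁻ ω, Φ (tStar ω) (X ω) ∂P =
      ∫⁻ q, Φ q.1 q.2 ∂(P.map fun ω => (tStar ω, X ω)) :=
    (lintegral_map hm (ht.prodMk hX)).symm
  rw [e1, (indepFun_iff_map_prod_eq_prod_map_map ht.aemeasurable hX.aemeasurable).1 hind,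
    lintegral_prod _ hm.aemeasurable, hlaw, uniformOn, ProbabilityTheory.cond, lintegral_smul_measure,
    ← Finset.coe_Icc, lintegral_finset]
  simp only [Measure.count_apply_finset, Nat.card_Icc, add_tsub_cancel_right, smul_eq_mul,
    Measure.count_singleton, mul_one]
  congr 1
  exact Finset.sum_congr rfl fun t _ => lintegral_map (hΦ t) hX

/-- A bound on the second moment bounds the first moment. -/
lemma integral_le_of_lintegral_sq_le {Y : Ω → ℝ} (hY : Measurable Y) (h0 : ∀ ω, 0 ≤ Y ω) {ε : ℝ}
    (hε : 0 < ε) (h : ∫⁻ ω, ENNReal.ofReal (Y ω ^ 2) ∂P ≤ ENNReal.ofReal (ε ^ 2)) :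
    Integrable Y P ∧ ∫ ω, Y ω ∂P ≤ ε := by
  have h1 : ∫⁻ ω, ENNReal.ofReal (Y ω) ∂P ≤ ENNReal.ofReal ε := by
    calc ∫⁻ ω, ENNReal.ofReal (Y ω) ∂P
        ≤ ∫⁻ ω, (ENNReal.ofReal (1 / (2 * ε)) * ENNReal.ofReal (Y ω ^ 2) +
            ENNReal.ofReal (ε / 2)) ∂P := by
          refine lintegral_mono fun ω => ?_
          rw [← ENNReal.ofReal_mul (by positivity), ← ENNReal.ofReal_add (by positivity)
            (by positivity)]
          refine ENNReal.ofReal_le_ofReal ?_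
          have h2 : 0 ≤ (Y ω - ε) ^ 2 / (2 * ε) := by positivity
          have h3 : (Y ω - ε) ^ 2 / (2 * ε) = 1 / (2 * ε) * Y ω ^ 2 + ε / 2 - Y ω := by
            field_simp; ring
          linarith
      _ = ENNReal.ofReal (1 / (2 * ε)) * ∫⁻ ω, ENNReal.ofReal (Y ω ^ 2) ∂P +
            ENNReal.ofReal (ε / 2) := by
          rw [lintegral_add_right _ measurable_const,
            lintegral_const_mul _ (hY.pow_const 2).ennreal_ofReal, lintegral_const, measure_univ,
            mul_one]
      _ ≤ ENNReal.ofReal (1 / (2 * ε)) * ENNReal.ofReal (ε ^ 2) + ENNReal.ofReal (ε / 2) := by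
          gcongr
      _ = ENNReal.ofReal ε := by
          rw [← ENNReal.ofReal_mul (by positivity), ← ENNReal.ofReal_add (by positivity)
            (by positivity)]
          congr 1
          field_simp; ring
  constructor
  · refine ⟨hY.aestronglyMeasurable, ?_⟩
    rw [hasFiniteIntegral_iff_ofReal (Filter.Eventually.of_forall h0)]
    exact h1.trans_lt ENNReal.ofReal_lt_top
  · rw [integral_eq_lintegral_of_nonneg_ae (Filter.Eventually.of_forall h0)
      hY.aestronglyMeasurable]
    exact ENNReal.toReal_le_of_le_ofReal hε.le h1

end RandomIndex

/-! ### The parameter choice -/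

section Parameters

variable {Lf ρ a σbar : ℝ} {T : ℕ}

lemma two_le_lamParam (hLf : 0 ≤ Lf) (hρ : 0 ≤ ρ) (a : ℝ) : 2 ≤ lamParam Lf ρ a := by
  have := two_le_muParam Lf
  have : 0 ≤ ρ * a ^ 2 := by positivity
  unfold lamParam
  linarith

lemma muParam_le_lamParam (hLf : 0 ≤ Lf) (hρ : 0 ≤ ρ) (a : ℝ) :
    muParam Lf ≤ lamParam Lf ρ a := by
  have : 0 ≤ ρ * a ^ 2 := by positivity
  unfold lamParam
  linarith

lemma one_le_sqrt_natCast (hT : 1 ≤ T) : 1 ≤ √(T : ℝ) :=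
  Real.one_le_sqrt.2 (by exact_mod_cast hT)

lemma tauParam_pos (hLf : 0 ≤ Lf) (hρ : 0 ≤ ρ) (a : ℝ) (hT : 1 ≤ T) :
    0 < tauParam Lf ρ a T := by
  have h1 := two_le_lamParam hLf hρ a
  have h2 := one_le_sqrt_natCast hT
  unfold tauParam
  positivity

lemma tauParam_mul_sq_le (hLf : 0 ≤ Lf) (hρ : 0 ≤ ρ) (a : ℝ) (hT : 1 ≤ T) :
    tauParam Lf ρ a T * lamParam Lf ρ a ^ 2 ≤ 1 / 6 := by
  have h1 := two_le_lamParam hLf hρ a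
  have h2 := one_le_sqrt_natCast hT
  rw [tauParam, one_div_mul_eq_div, div_le_iff₀ (by positivity)]
  have := mul_le_mul_of_nonneg_left h2 (sq_nonneg (lamParam Lf ρ a))
  linarith

lemma tauParam_sq_le (hLf : 0 ≤ Lf) (hρ : 0 ≤ ρ) (a : ℝ) (hT : 1 ≤ T) :
    tauParam Lf ρ a T ^ 2 ≤ 1 / T := by
  have h1 := two_le_lamParam hLf hρ a
  have h2 := one_le_sqrt_natCast hT
  have h3 : tauParam Lf ρ a T ≤ 1 / √(T : ℝ) := by
    unfold tauParam
    refine one_div_le_one_div_of_le (by positivity) (le_mul_of_one_le_left (by positivity) ?_)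
    nlinarith
  have h4 := pow_le_pow_left₀ (tauParam_pos hLf hρ a hT).le h3 2
  rwa [div_pow, one_pow, Real.sq_sqrt (Nat.cast_nonneg T)] at h4

lemma gammaS_pos (hρ : 0 ≤ ρ) (a : ℝ) : 0 < gammaS Lf ρ a := by
  have := muParam_pos Lf
  unfold gammaS
  positivity

lemma etaParam_pos (hLf : 0 ≤ Lf) (hρ : 0 ≤ ρ) (ha : 0 ≤ a) (hT : 1 ≤ T) :
    0 < etaParam Lf ρ a T := by
  have h1 := tauParam_pos hLf hρ a hT
  have h2 := gammaS_pos (Lf := Lf) hρ a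
  unfold etaParam
  split_ifs with h0
  · exact h1
  · have : 0 < a := lt_of_le_of_ne ha (Ne.symm h0)
    exact lt_min (by positivity) (lt_min (by positivity) (by positivity))

lemma etaParam_mul_sq_le (hLf : 0 ≤ Lf) (hρ : 0 ≤ ρ) (a : ℝ) (hT : 1 ≤ T) :
    etaParam Lf ρ a T * a ^ 2 ≤ tauParam Lf ρ a T / 200 := by
  have h1 := tauParam_pos hLf hρ a hT
  by_cases h0 : a = 0
  · rw [show etaParam Lf ρ a T * a ^ 2 = 0 by simp [h0]]
    positivity
  · have h2 : etaParam Lf ρ a T ≤ tauParam Lf ρ a T / (200 * a ^ 2) := by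
      rw [etaParam, if_neg h0]
      exact (min_le_right _ _).trans (min_le_left _ _)
    have h3 : 0 < a ^ 2 := by positivity
    rw [le_div_iff₀ (by positivity)] at h2
    linarith

lemma betaParam_pos (hLf : 0 ≤ Lf) (hρ : 0 ≤ ρ) (ha : 0 ≤ a) (hσ : 0 < σbar) (hT : 1 ≤ T) :
    0 < betaParam Lf ρ a σbar T := by
  have h1 := tauParam_pos hLf hρ a hT
  have h2 := etaParam_pos hLf hρ ha hT
  have h3 := two_le_lamParam hLf hρ a
  have h4 := muParam_pos Lf
  exact lt_min (by positivity) (lt_min (by positivity) (by positivity))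

lemma tauParam_one_div (Lf ρ a : ℝ) (T : ℕ) :
    tauParam Lf ρ a 1 / √(T : ℝ) = tauParam Lf ρ a T := by
  simp only [tauParam, Nat.cast_one, Real.sqrt_one, mul_one]
  rw [div_div]

lemma etaParam_one_div_le (hρ : 0 ≤ ρ) (hT : 1 ≤ T) :
    etaParam Lf ρ a 1 / √(T : ℝ) ≤ etaParam Lf ρ a T := by
  have h2 := one_le_sqrt_natCast hT
  have h3 := gammaS_pos (Lf := Lf) hρ a
  have e := tauParam_one_div Lf ρ a T
  unfold etaParam
  split_ifs with h0
  · exact e.le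
  · refine le_min ?_ (le_min ?_ ?_)
    · refine (div_le_div_of_nonneg_right (min_le_left _ _) (by positivity)).trans ?_
      exact div_le_self (by positivity) h2
    · refine (div_le_div_of_nonneg_right ((min_le_right _ _).trans (min_le_left _ _))
        (by positivity)).trans_eq ?_
      rw [← e]; ring
    · refine (div_le_div_of_nonneg_right ((min_le_right _ _).trans (min_le_right _ _))
        (by positivity)).trans_eq ?_
      rw [← e]; ring

/-- The proximal step size decays no faster than `1 / √T`, since the terms of the minima that
define it are either constant in `T` or proportional to `1 / √T`. The descent per iteration is
proportional to it. -/
lemma betaParam_one_div_le (hLf : 0 ≤ Lf) (hρ : 0 ≤ ρ) (hT : 1 ≤ T) :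
    betaParam Lf ρ a σbar 1 / √(T : ℝ) ≤ betaParam Lf ρ a σbar T := by
  have h2 := one_le_sqrt_natCast hT
  have h3 := two_le_lamParam hLf hρ a
  have h4 := muParam_pos Lf
  have e := tauParam_one_div Lf ρ a T
  refine le_min ?_ (le_min ?_ ?_)
  · refine (div_le_div_of_nonneg_right (min_le_left _ _) (by positivity)).trans_eq ?_
    rw [← e]; ring
  · refine (div_le_div_of_nonneg_right ((min_le_right _ _).trans (min_le_left _ _))
      (by positivity)).trans ?_
    exact div_le_self (by positivity) h2
  · refine (div_le_div_of_nonneg_right ((min_le_right _ _).trans (min_le_right _ _))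
      (by positivity)).trans ?_
    rw [div_right_comm]
    exact div_le_div_of_nonneg_right (etaParam_one_div_le hρ hT) (by positivity)

lemma admissible_params {n m p : ℕ} {Q : Problem n m p} (hLf : 0 ≤ Lf) (hρ : 0 ≤ ρ)
    (hf : IsSmoothFun Lf Q.f) (hne : Q.feasible.Nonempty) (hσ : 0 < σbar)
    (hE : Q.IsErrorBound ρ (muParam Lf) σbar) (hT : 1 ≤ T) :
    Admissible Q (params Lf ρ ‖Q.A‖ σbar T) Lf σbar where
  smooth := hf
  L_nonneg := hLf
  rho_nonneg := hρ
  two_le_mu := two_le_muParam Lf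
  four_mul_le_mu := four_mul_le_muParam Lf
  tau_pos := tauParam_pos hLf hρ _ hT
  tau_le := tauParam_mul_sq_le hLf hρ _ hT
  eta_pos := etaParam_pos hLf hρ (norm_nonneg _) hT
  eta_le := etaParam_mul_sq_le hLf hρ _ hT
  beta_pos := betaParam_pos hLf hρ (norm_nonneg _) hσ hT
  beta_le := min_le_left _ _
  beta_le_eta := by
    have h4 := muParam_pos Lf
    have h : betaParam Lf ρ ‖Q.A‖ σbar T ≤
        etaParam Lf ρ ‖Q.A‖ T / (36 * muParam Lf * σbar ^ 2) :=
      (min_le_right _ _).trans (min_le_right _ _)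
    rw [le_div_iff₀ (by positivity), mul_comm] at h
    exact h
  nonempty := hne
  errorBound := hE

end Parameters

/-! ### Rate of convergence -/

section Complexity

variable {n m p : ℕ} {Q : Problem n m p} {Lf ρ σbar : ℝ}

/-- The constant `C` in the bound `E ‖z_{t*} - x̄(z_{t*})‖² ≤ C / √T`: the initial potential gap and
the accumulated noise `(T + 1) · 2 τ² σ² ≤ 4 σ²`, divided by the descent coefficient `μ β / 12`, in
which `β` is taken at `T = 1`. -/
def rateConst (Q : Problem n m p) (Lf ρ σbar σ fLow : ℝ) (x₀ : Vec n) (y₀ : Vec m) : ℝ :=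
  12 / (muParam Lf * betaParam Lf ρ ‖Q.A‖ σbar 1) *
    (Q.potential ρ (muParam Lf) ⟨x₀, y₀, x₀⟩ - fLow + 4 * σ ^ 2)

lemma rateConst_nonneg (hLf : 0 ≤ Lf) (hρ : 0 ≤ ρ) (hf : IsSmoothFun Lf Q.f)
    (hne : Q.feasible.Nonempty) (hσ : 0 < σbar)
    (hE : Q.IsErrorBound ρ (muParam Lf) σbar) {fLow : ℝ} (hlow : ∀ x ∈ Q.feasible, fLow ≤ Q.f x)
    (x₀ : Vec n) (y₀ : Vec m) (σ : ℝ) : 0 ≤ rateConst Q Lf ρ σbar σ fLow x₀ y₀ := by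
  have h1 := muParam_pos Lf
  have h2 := betaParam_pos hLf hρ (norm_nonneg Q.A) hσ le_rfl
  have h3 : fLow ≤ Q.potential ρ (muParam Lf) ⟨x₀, y₀, x₀⟩ :=
    (admissible_params hLf hρ hf hne hσ hE le_rfl).le_potential hlow ⟨x₀, y₀, x₀⟩
  have h4 := sub_nonneg.2 h3
  unfold rateConst
  positivity

/-- The rate of the algorithm in terms of the squared distance of `z` to its proximal point. -/
lemma lintegral_norm_sub_xBar_sq_le (hLf : 0 ≤ Lf) (hρ : 0 ≤ ρ) (hf : IsSmoothFun Lf Q.f)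
    (hne : Q.feasible.Nonempty) (hσ : 0 < σbar)
    (hE : Q.IsErrorBound ρ (muParam Lf) σbar) {fLow : ℝ} (hlow : ∀ x ∈ Q.feasible, fLow ≤ Q.f x)
    (x₀ : Vec n) (y₀ : Vec m) {σ : ℝ} {Ξ Ω : Type*} [MeasurableSpace Ξ] [MeasurableSpace Ω]
    {D : Measure Ξ} {P : Measure Ω} [IsProbabilityMeasure P] {F : Vec n → Ξ → Vec n}
    {ξ : ℕ → Ω → Ξ} (hF : IsStochGrad Q.f F D σ) (hξ : ∀ t, Measurable (ξ t))
    (hlaw : ∀ t, P.map (ξ t) = D) (hind : iIndepFun ξ P) {T : ℕ} (hT : 1 ≤ T)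
    {tStar : Ω → ℕ} (ht : Measurable tStar) (htlaw : P.map tStar = uniformOn (Set.Icc 1 T))
    (htind : IndepFun tStar (fun ω t => ξ t ω) P) :
    ∫⁻ ω, ENNReal.ofReal (‖Q.zIter (params Lf ρ ‖Q.A‖ σbar T) x₀ y₀ F (fun t => ξ t ω) (tStar ω) -
      Q.xBar (muParam Lf) (Q.zIter (params Lf ρ ‖Q.A‖ σbar T) x₀ y₀ F (fun t => ξ t ω)
        (tStar ω))‖ ^ 2) ∂P ≤
      ENNReal.ofReal (rateConst Q Lf ρ σbar σ fLow x₀ y₀ / √(T : ℝ)) := by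
  have h := admissible_params hLf hρ hf hne hσ hE hT
  have hτ2 := tauParam_sq_le hLf hρ ‖Q.A‖ hT
  have hβ1 := betaParam_pos hLf hρ (norm_nonneg Q.A) hσ le_rfl
  have hβ := betaParam_pos hLf hρ (norm_nonneg Q.A) hσ hT
  have hββ : betaParam Lf ρ ‖Q.A‖ σbar 1 / √(T : ℝ) ≤ betaParam Lf ρ ‖Q.A‖ σbar T :=
    betaParam_one_div_le hLf hρ hT
  have hμ := muParam_pos Lf
  have hsq := one_le_sqrt_natCast hT
  have hTpos : (0 : ℝ) < T := by exact_mod_cast hT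
  set θ := params Lf ρ ‖Q.A‖ σbar T with hθ
  set G : State n m → ℝ := fun s => ‖s.z - Q.xBar (muParam Lf) s.z‖ ^ 2 with hG
  have hzm : Measurable fun s : State n m => s.z := (measurable_state_iff.1 measurable_id).2.2
  have hxb : Measurable (Q.xBar (muParam Lf)) :=
    (Problem.continuous_xBar hf h.L_lt_mu h.mu_nonneg hne).measurable
  have hGm : Measurable G := (hzm.sub (hxb.comp hzm)).norm.pow_const 2
  have hΦ : ∀ t, Measurable fun ζ : ℕ → Ξ =>
      ENNReal.ofReal (G (Q.stateAt θ x₀ y₀ F ζ t)) := fun t =>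
    (hGm.comp (h.measurable_stateAt x₀ y₀ hF.measurable (ζ := fun i (ζ : ℕ → Ξ) => ζ i) t
      fun i _ => measurable_pi_apply i)).ennreal_ofReal
  have hX : Measurable fun ω t => ξ t ω := measurable_pi_lambda _ hξ
  simp only [Problem.zIter_eq]
  have e1 := lintegral_uniform_index ht htlaw hX htind hΦ
  refine e1.trans_le ?_
  set q := muParam Lf * betaParam Lf ρ ‖Q.A‖ σbar T / 12 with hq
  have hq0 : 0 < q := by positivity
  set Δ := Q.potential ρ (muParam Lf) ⟨x₀, y₀, x₀⟩ - fLow with hΔ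
  have hΔ0 : 0 ≤ Δ := sub_nonneg.2 (h.le_potential hlow ⟨x₀, y₀, x₀⟩)
  -- `T + 1` iterations are counted, since the iterate `z_T` is among the possible outputs
  have hsum := h.sum_lintegral_le hlow hF x₀ y₀ hξ hlaw hind (T + 1)
  have hsum' : ENNReal.ofReal q * ∑ t ∈ Finset.Icc 1 T,
      ∫⁻ ω, ENNReal.ofReal (G (Q.stateAt θ x₀ y₀ F (fun i => ξ i ω) t)) ∂P ≤
      ENNReal.ofReal (Δ + (T + 1 : ℕ) * (2 * tauParam Lf ρ ‖Q.A‖ T ^ 2 * σ ^ 2)) := by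
    refine le_trans ?_ hsum
    rw [Finset.mul_sum]
    have hsub : Finset.Icc 1 T ⊆ Finset.range (T + 1) := fun t ht => by
      rw [Finset.mem_Icc] at ht
      rw [Finset.mem_range]
      omega
    refine le_trans (le_of_eq (Finset.sum_congr rfl fun t _ => ?_))
      (Finset.sum_le_sum_of_subset hsub)
    rw [← lintegral_const_mul' _ _ ENNReal.ofReal_ne_top]
    refine lintegral_congr fun ω => ?_
    exact (ENNReal.ofReal_mul hq0.le).symm
  have hnum : Δ + (T + 1 : ℕ) * (2 * tauParam Lf ρ ‖Q.A‖ T ^ 2 * σ ^ 2) ≤ Δ + 4 * σ ^ 2 := by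
    have h1 : ((T + 1 : ℕ) : ℝ) ≤ 2 * T := by
      have : (1 : ℝ) ≤ T := by exact_mod_cast hT
      push_cast
      linarith
    have h2 : ((T + 1 : ℕ) : ℝ) * tauParam Lf ρ ‖Q.A‖ T ^ 2 ≤ 2 := by
      calc ((T + 1 : ℕ) : ℝ) * tauParam Lf ρ ‖Q.A‖ T ^ 2 ≤ 2 * T * (1 / T) := by gcongr
        _ = 2 := by field_simp
    have h3 := mul_le_mul_of_nonneg_right h2 (sq_nonneg σ)
    linarith
  have hsum2 := hsum'.trans (ENNReal.ofReal_le_ofReal hnum)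
  set W := ∑ t ∈ Finset.Icc 1 T,
      ∫⁻ ω, ENNReal.ofReal (G (Q.stateAt θ x₀ y₀ F (fun i => ξ i ω) t)) ∂P
  have hW : W ≤ ENNReal.ofReal ((Δ + 4 * σ ^ 2) / q) := by
    rw [ENNReal.ofReal_div_of_pos hq0, ENNReal.le_div_iff_mul_le
      (Or.inl (ENNReal.ofReal_pos.2 hq0).ne') (Or.inl ENNReal.ofReal_ne_top), mul_comm]
    exact hsum2
  calc (T : ENNReal)⁻¹ * W ≤ (T : ENNReal)⁻¹ * ENNReal.ofReal ((Δ + 4 * σ ^ 2) / q) := by gcongr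
    _ = ENNReal.ofReal ((T : ℝ)⁻¹ * ((Δ + 4 * σ ^ 2) / q)) := by
      rw [ENNReal.ofReal_mul (by positivity), ENNReal.ofReal_inv_of_pos hTpos,
        ENNReal.ofReal_natCast]
    _ ≤ _ := by
      refine ENNReal.ofReal_le_ofReal ?_
      have h1 : muParam Lf * betaParam Lf ρ ‖Q.A‖ σbar 1 / (12 * √(T : ℝ)) ≤ q := by
        rw [hq]
        calc muParam Lf * betaParam Lf ρ ‖Q.A‖ σbar 1 / (12 * √(T : ℝ)) =
            muParam Lf * (betaParam Lf ρ ‖Q.A‖ σbar 1 / √(T : ℝ)) / 12 := by ring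
          _ ≤ _ := by gcongr
      calc (T : ℝ)⁻¹ * ((Δ + 4 * σ ^ 2) / q) ≤ (T : ℝ)⁻¹ * ((Δ + 4 * σ ^ 2) /
            (muParam Lf * betaParam Lf ρ ‖Q.A‖ σbar 1 / (12 * √(T : ℝ)))) := by gcongr
        _ = rateConst Q Lf ρ σbar σ fLow x₀ y₀ / √(T : ℝ) := by
          rw [rateConst, ← hΔ]
          have hTs : (T : ℝ) = √(T : ℝ) * √(T : ℝ) := (Real.mul_self_sqrt hTpos.le).symm
          generalize √(T : ℝ) = r at *
          rw [hTs]
          field_simp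

end Complexity

end SmoothedALM

end

/-! ### Error bound and oracle complexity -/

theorem mainTheorem1 {n m p : ℕ}
    (A : SmoothedALM.Vec n →L[ℝ] SmoothedALM.Vec m)
    (H : SmoothedALM.Vec n →L[ℝ] SmoothedALM.Vec p)
    (Lf ρ : ℝ) (hLf : 0 ≤ Lf) (hρ : 0 ≤ ρ) :
    -- a global error bound constant exists that depends only on `A`, `H`, `L_f`, `ρ`
    (∃ σbar : ℝ, 0 < σbar ∧
      ∀ Q : SmoothedALM.Problem n m p, Q.A = A → Q.H = H → SmoothedALM.IsSmoothFun Lf Q.f →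
        Q.IsErrorBound ρ (SmoothedALM.muParam Lf) σbar) ∧
    -- the complexity bound, with any error bound constant `σbar` in the step sizes
    ∀ Q : SmoothedALM.Problem n m p, Q.A = A → Q.H = H → SmoothedALM.IsSmoothFun Lf Q.f →
      Q.feasible.Nonempty → (∃ fLow : ℝ, ∀ x ∈ Q.feasible, fLow ≤ Q.f x) →
      ∀ σbar : ℝ, 0 < σbar → Q.IsErrorBound ρ (SmoothedALM.muParam Lf) σbar →
      ∀ κ ∈ ({SmoothedALM.muParam Lf, SmoothedALM.lamParam Lf ρ ‖A‖} : Set ℝ),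
        Differentiable ℝ (Q.envelope κ) ∧
        ∀ (x₀ : SmoothedALM.Vec n) (y₀ : SmoothedALM.Vec m) (σ : ℝ), x₀ ∈ Q.X → 0 ≤ σ →
          ∃ c₁ c₂ : ℝ, 0 < c₁ ∧ 0 < c₂ ∧
            (∀ ε : ℝ, 0 < ε → ε ≤ 1 →
              ∃ T : ℕ, c₁ * (ε ^ 4)⁻¹ ≤ T ∧ T ≤ c₂ * (ε ^ 4)⁻¹) ∧
            ∀ {Ξ Ω : Type*} [MeasurableSpace Ξ] [MeasurableSpace Ω]
              (D : Measure Ξ) (P : Measure Ω) [IsProbabilityMeasure P]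
              (F : SmoothedALM.Vec n → Ξ → SmoothedALM.Vec n) (ξ : ℕ → Ω → Ξ),
              SmoothedALM.IsStochGrad Q.f F D σ →
              (∀ t, Measurable (ξ t)) → (∀ t, P.map (ξ t) = D) → iIndepFun ξ P →
              ∀ (ε : ℝ) (T : ℕ), 0 < ε → 1 ≤ T → c₁ * (ε ^ 4)⁻¹ ≤ T →
              -- exactly one oracle call per iteration
              (∀ ω, Q.oracleCalls (SmoothedALM.params Lf ρ ‖A‖ σbar T) x₀ y₀ F
                (fun t => ξ t ω) T = T) ∧
              -- `tStar` is uniform on `{1, …, T}` and independent of the samples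
              ∀ tStar : Ω → ℕ, Measurable tStar →
                P.map tStar = uniformOn (Set.Icc 1 T) →
                IndepFun tStar (fun ω t => ξ t ω) P →
                Integrable (fun ω => ‖gradient (Q.envelope κ)
                  (Q.zIter (SmoothedALM.params Lf ρ ‖A‖ σbar T) x₀ y₀ F
                    (fun t => ξ t ω) (tStar ω))‖) P ∧
                ∫ ω, ‖gradient (Q.envelope κ)
                  (Q.zIter (SmoothedALM.params Lf ρ ‖A‖ σbar T) x₀ y₀ F
                    (fun t => ξ t ω) (tStar ω))‖ ∂P ≤ ε := by
  refine ⟨SmoothedALM.exists_isErrorBound A H hLf ρ, ?_⟩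
  rintro Q rfl rfl hf hne ⟨fLow, hlow⟩ σbar hσbar hE κ hκ
  have hμ2 := SmoothedALM.two_le_muParam Lf
  have hμL := SmoothedALM.muParam_sub_pos Lf
  have hlam := SmoothedALM.muParam_le_lamParam hLf hρ ‖Q.A‖
  have hκ1 : SmoothedALM.muParam Lf ≤ κ := by
    rcases hκ with rfl | rfl
    · exact le_rfl
    · exact hlam
  have hκ2 : κ ≤ SmoothedALM.lamParam Lf ρ ‖Q.A‖ := by
    rcases hκ with rfl | rfl
    · exact hlam
    · exact le_rfl
  have hκ0 : 0 ≤ κ := by linarith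
  have hκL : Lf < κ := by linarith
  refine ⟨SmoothedALM.Problem.differentiable_envelope hf hκL hκ0 hne, fun x₀ y₀ σ _ _ => ?_⟩
  -- the squared gradient is at most `λ²` times the squared distance to the proximal point
  set C := SmoothedALM.rateConst Q Lf ρ σbar σ fLow x₀ y₀ with hC
  have hC0 : 0 ≤ C := SmoothedALM.rateConst_nonneg hLf hρ hf hne hσbar hE hlow x₀ y₀ σ
  set B := SmoothedALM.lamParam Lf ρ ‖Q.A‖ ^ 2 * C with hB
  have hB0 : 0 ≤ B := by positivity
  refine ⟨B ^ 2 + 1, B ^ 2 + 2, by positivity, by positivity, fun ε hε hε1 => ?_, ?_⟩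
  · refine ⟨⌈(B ^ 2 + 1) * (ε ^ 4)⁻¹⌉₊, Nat.le_ceil _, ?_⟩
    have h1 : 1 ≤ (ε ^ 4)⁻¹ := (one_le_inv₀ (by positivity)).2 (pow_le_one₀ hε.le hε1)
    have h2 := (Nat.ceil_lt_add_one
      (show 0 ≤ (B ^ 2 + 1) * (ε ^ 4)⁻¹ by positivity)).le
    linarith
  · intro Ξ Ω _ _ D P _ F ξ hF hξ hlaw hind ε T hε hT hTε
    refine ⟨fun ω => SmoothedALM.Problem.oracleCalls_eq _ _ _ _ _ _ _, ?_⟩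
    intro tStar ht htlaw htind
    have h := SmoothedALM.admissible_params hLf hρ hf hne hσbar hE hT
    have hrate := SmoothedALM.lintegral_norm_sub_xBar_sq_le hLf hρ hf hne hσbar hE hlow x₀ y₀
      hF hξ hlaw hind hT ht htlaw htind
    set θ := SmoothedALM.params Lf ρ ‖Q.A‖ σbar T with hθ
    have hzm : Measurable fun ω => Q.zIter θ x₀ y₀ F (fun t => ξ t ω) (tStar ω) := by
      have h1 : Measurable fun q : ℕ × Ω => Q.zIter θ x₀ y₀ F (fun t => ξ t q.2) q.1 := by
        refine measurable_from_prod_countable_right fun t => ?_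
        simp only [SmoothedALM.Problem.zIter_eq]
        exact (SmoothedALM.measurable_state_iff.1
          (h.measurable_stateAt x₀ y₀ hF.measurable t fun i _ => hξ i)).2.2
      exact h1.comp (ht.prodMk measurable_id)
    have hgrad : ∀ z, gradient (Q.envelope κ) z = κ • (z - Q.xBar κ z) :=
      SmoothedALM.Problem.gradient_envelope hf hκL hκ0 hne
    have hxb := (SmoothedALM.Problem.continuous_xBar hf hκL hκ0 hne).measurable
    simp only [hgrad]
    refine SmoothedALM.integral_le_of_lintegral_sq_le
      (((hzm.sub (hxb.comp hzm)).const_smul κ).norm) (fun ω => norm_nonneg _) hε ?_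
    have hpt : ∀ z, ‖κ • (z - Q.xBar κ z)‖ ^ 2 ≤ SmoothedALM.lamParam Lf ρ ‖Q.A‖ ^ 2 *
        ‖z - Q.xBar (SmoothedALM.muParam Lf) z‖ ^ 2 := by
      intro z
      have h1 := SmoothedALM.Problem.norm_sub_xBar_le hf (by linarith) hκ1 hne z
      rw [norm_smul, Real.norm_of_nonneg hκ0, mul_pow]
      gcongr
    have hsq : B ≤ ε ^ 2 * √(T : ℝ) := by
      have h1 : B ^ 2 ≤ ε ^ 4 * T := by
        have h2 := mul_le_mul_of_nonneg_left hTε (show 0 ≤ ε ^ 4 by positivity)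
        have h3 : ε ^ 4 * ((B ^ 2 + 1) * (ε ^ 4)⁻¹) = B ^ 2 + 1 := by field_simp
        linarith
      refine le_of_sq_le_sq ?_ (by positivity)
      rw [mul_pow (ε ^ 2), Real.sq_sqrt (Nat.cast_nonneg T)]
      linarith
    have hsqrt : 0 < √(T : ℝ) := lt_of_lt_of_le one_pos (SmoothedALM.one_le_sqrt_natCast hT)
    have hl0 : 0 ≤ SmoothedALM.lamParam Lf ρ ‖Q.A‖ ^ 2 := sq_nonneg _
    refine (lintegral_mono fun ω => ENNReal.ofReal_le_ofReal (hpt _)).trans ?_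
    simp only [ENNReal.ofReal_mul hl0]
    rw [lintegral_const_mul' _ _ ENNReal.ofReal_ne_top]
    refine (mul_le_mul_right hrate _).trans ?_
    rw [← ENNReal.ofReal_mul hl0]
    refine ENNReal.ofReal_le_ofReal ?_
    rw [← mul_div_assoc, div_le_iff₀ hsqrt]
    exact hsq
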